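/- Let $1\le M<N$, $\beta,\delta,\epsilon\in(0,1)$, and let $\Theta=\{\beta,2\beta,\dots,(\lfloor 1/\beta\rfloor-1)\beta\}^N$ be nonempty, with the uniform prior $\pi$. For $\theta\in\Theta$ let $X_1,X_2,\dots\in\{0,1\}^N$ be i.i.d. reward vectors with independent coordinates $X_{t,i}\sim\mathrm{Bernoulli}(\theta_i)$. The actions $\mathcal A$ are the subsets $a\subseteq\{1,\dots,N\}$ of size $M$; playing $a$ in round $t$ reveals the rewards $(X_{t,i})_{i\in a}$ of all chosen arms and pays $u\big(\sum_{i\in a}X_{t,i}\big)$, where $u:\{0,\dots,M\}\to\mathbb R$ is a fixed nondecreasing function with $u(0)<u(M)$ (for instance $u(s)=s$, the total reward). For $\theta\in\Theta$ let $a^*(\theta)$ be an action of maximal expected reward under $\theta$, with ties broken by an arbitrary fixed rule. Thompson sampling starts from $\pi_0=\pi$; in round $t$ it draws $\theta_t\sim\pi_{t-1}$, plays $A_t=a^*(\theta_t)$, observes the rewards of the arms in $A_t$, and lets $\pi_t$ be the Bayes posterior of $\pi_{t-1}$ given this observation. Let $N_T(a)$ be the number of rounds $t\le T$ with $A_t=a$,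 and for $p,q\in(0,1)$ let $D(p\|q)=p\log\frac pq+(1-p)\log\frac{1-p}{1-q}$. Then there is a constant $\mathsf B_2$, depending only on $\delta,\epsilon,N,M,\beta$ and $u$ (and not on $T$), such that the following holds for every $\mu\in\Theta$ with $\mu_1\le\dots\le\mu_N$ and $\mu_{N-M}<\mu_{N-M+1}$. There is $T^\star\ge0$ such that for all $T\ge T^\star$, when the true arm parameters are $\mu$, with probability at least $1-\delta$, $$\sum_{a\ne a^*(\mu)}N_T(a)\;\le\;\mathsf B_2+\frac{1+\epsilon}{1-\epsilon}\sum_{i=1}^{N-M}\frac{1}{D(\mu_i\|\mu_{N-M+1})}\,\log T .$$ For $M=1$ the sum $\sum_{i=1}^{N-M}\frac1{D(\mu_i\|\mu_{N-M+1})}$ equals the Lai–Robbins constant $\sum_{i:\,\mu_i<\max_j\mu_j}\frac1{D(\mu_i\|\max_j\mu_j)}$ for the number of suboptimal plays. -/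

import Mathlib

open scoped ENNReal

noncomputable section

namespace SubsetBandit

/-! ### Thompson sampling in a general bandit with finitely supported beliefs -/

section General

variable {Θ X A Y : Type*}

theorem bayes_ne_top (ρ : PMF Θ) (l : Θ → PMF Y) (y : Y) : ∑' θ, ρ θ * l θ y ≠ ∞ := by
  refine ne_top_of_le_ne_top ENNReal.one_ne_top ?_
  calc ∑' θ, ρ θ * l θ y ≤ ∑' θ, ρ θ :=
        ENNReal.tsum_le_tsum fun θ => mul_le_of_le_one_right' ((l θ).coe_le_one y)
    _ = 1 := ρ.tsum_coe

open Classical in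
/-- Bayes update of the belief `ρ` after observing `y`, where `l θ` is the law of the observation
under the model `θ`: the new mass of `θ` is `l θ y * ρ θ / ∑ θ', l θ' y * ρ θ'`.
(An observation which has probability zero under the belief leaves it unchanged.) -/
def bayesUpdate (ρ : PMF Θ) (l : Θ → PMF Y) (y : Y) : PMF Θ :=
  if h : ∑' θ, ρ θ * l θ y ≠ 0 then
    PMF.normalize (fun θ => ρ θ * l θ y) h (bayes_ne_top ρ l y)
  else ρ

/-- The belief `π_t` of Thompson sampling. A history is the list of the pairs `(θ_s, X_s)` of the
sampled model and the basic outcome in the rounds played so far, the most recent round first.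
In the round `(θ, x)` the action `astar θ` is played and only `f x (astar θ)` is observed. -/
def posterior (prior : PMF Θ) (lik : A → Θ → PMF Y) (f : X → A → Y) (astar : Θ → A) :
    List (Θ × X) → PMF Θ
  | [] => prior
  | (θ, x) :: h =>
      bayesUpdate (posterior prior lik f astar h) (lik (astar θ)) (f x (astar θ))

/-- The law of the history of the first `t` rounds of Thompson sampling, when the basic outcomes
`X_1, X_2, …` are i.i.d. with law `envLaw`: in each round a model is drawn from the current
posterior, and, independently of it, the basic outcome from `envLaw`. -/
def thompsonLaw (prior : PMF Θ) (lik : A → Θ → PMF Y) (f : X → A → Y) (astar : Θ → A)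
    (envLaw : PMF X) : ℕ → PMF (List (Θ × X))
  | 0 => PMF.pure []
  | t + 1 =>
      (thompsonLaw prior lik f astar envLaw t).bind fun h =>
        (posterior prior lik f astar h).bind fun θ =>
          envLaw.bind fun x => PMF.pure ((θ, x) :: h)

/-- `N_T(a)`: the number of rounds of the history `h` in which the action `a` was played. -/
def plays [DecidableEq A] (astar : Θ → A) (h : List (Θ × X)) (a : A) : ℕ :=
  h.countP fun r => astar r.1 = a

end General

/-! ### Bernoulli arms, subset actions, full feedback -/

/-- Clamping to `[0, 1]`; the identity on the parameters used below. -/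
def clamp (p : ℝ) : ℝ := max 0 (min p 1)

/-- The Bernoulli law with success probability `p ∈ [0, 1]`. -/
def bernoulliLaw (p : ℝ) : PMF Bool :=
  PMF.ofFintype (fun b => ENNReal.ofReal (if b then clamp p else 1 - clamp p)) (by
    have h0 : 0 ≤ clamp p := le_max_left _ _
    have h1 : clamp p ≤ 1 := max_le zero_le_one (min_le_right _ _)
    rw [Fintype.sum_bool, ← ENNReal.ofReal_add (by simpa using h0) (by simpa using h1)]
    simp)

/-- The law of the rewards of all arms in one round: independent, arm `i` being
Bernoulli with parameter `θ i`. -/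
def armsLaw {N : ℕ} (θ : Fin N → ℝ) : PMF (Fin N → Bool) :=
  PMF.ofFintype (fun x => ∏ i, bernoulliLaw (θ i) (x i)) (by
    rw [← Fintype.prod_sum]
    refine Finset.prod_eq_one fun i _ => ?_
    exact (tsum_fintype (bernoulliLaw (θ i))).symm.trans (bernoulliLaw (θ i)).tsum_coe)

/-- The actions: all subsets of the `N` arms of size `M`. -/
abbrev Action (N M : ℕ) : Type := {a : Finset (Fin N) // a.card = M}

/-- Full feedback: the rewards of the `M` chosen arms, in increasing order of the arms. -/
def observe {N M : ℕ} (x : Fin N → Bool) (a : Action N M) : Fin M → Bool :=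
  fun k => x (a.1.orderEmbOfFin a.2 k)

/-- `l(· ; a, θ)`: the law of the observation when `a` is played in the model `θ`. -/
def likelihood {N M : ℕ} (a : Action N M) (θ : Fin N → ℝ) : PMF (Fin M → Bool) :=
  (armsLaw θ).map fun x => observe x a

/-- The reward of an observation: a function `u` of the total of the observed rewards. -/
def reward {M : ℕ} (u : ℕ → ℝ) (y : Fin M → Bool) : ℝ :=
  u (Finset.univ.filter fun k => y k = true).card

/-- Expected reward of the action `a` in the model `θ`. -/
def expectedReward {N M : ℕ} (u : ℕ → ℝ) (θ : Fin N → ℝ) (a : Action N M) : ℝ :=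
  ∑ x : Fin N → Bool, (armsLaw θ x).toReal * reward u (observe x a)

/-- The grid `{β, 2β, …, (⌊1/β⌋ - 1)β}^N`. -/
def grid (N : ℕ) (β : ℝ) : Finset (Fin N → ℝ) :=
  Fintype.piFinset fun _ => (Finset.Icc 1 (⌊1 / β⌋₊ - 1)).image fun k : ℕ => (k : ℝ) * β

/-- `astar` selects an optimal action in every model of the grid (ties broken arbitrarily). -/
def IsOptimalSelector {N M : ℕ} {β : ℝ} (u : ℕ → ℝ) (astar : grid N β → Action N M) : Prop :=
  ∀ (θ : grid N β) (a : Action N M), expectedReward u θ.1 a ≤ expectedReward u θ.1 (astar θ)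

/-- The law of the first `T` rounds of Thompson sampling with the uniform prior on the grid, when
the arms have the parameters `μ`. -/
def subsetThompsonLaw {N M : ℕ} {β : ℝ} [Nonempty (grid N β)]
    (astar : grid N β → Action N M) (μ : Fin N → ℝ) (T : ℕ) :
    PMF (List (grid N β × (Fin N → Bool))) :=
  thompsonLaw (PMF.uniformOfFintype (grid N β)) (fun a θ => likelihood a θ.1) observe astar
    (armsLaw μ) T

/-- Kullback-Leibler divergence between the Bernoulli laws with parameters `p, q ∈ (0, 1)`. -/
def klBernoulli (p q : ℝ) : ℝ :=
  p * Real.log (p / q) + (1 - p) * Real.log ((1 - p) / (1 - q))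

/-- The Lai-Robbins constant for the number of suboptimal plays of a Bernoulli bandit:
the sum of `1 / D(μ_i ‖ μ_max)` over the suboptimal arms `i`. -/
def laiRobbinsConstant {N : ℕ} (μ : Fin N → ℝ) : ℝ :=
  ∑ i ∈ Finset.univ.filter (fun i => μ i < ⨆ j, μ j), 1 / klBernoulli (μ i) (⨆ j, μ j)

end SubsetBandit

end

namespace SubsetBandit

noncomputable section

/-! Under `μ` the likelihood ratio of every model `θ` against `μ` is a positive martingale started
at 1. Since the prior is uniform, the posterior mass of `θ` is its ratio divided by the sum of all
ratios (`belief_eq`). By the maximal inequality this sum stays below a constant `c` at all times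
with high probability, and then the truth keeps posterior mass at least `1 / c` (`inv_le_belief`).

There are two kinds of harmful models. If `θ` differs from `μ` on an arm of the optimal action, each
sampling of `μ` yields evidence against `θ`: the `γ`-th power of its ratio, `0 < γ < 1`, loses a
fixed fraction per round in expectation. This power dominates the posterior mass, so `θ` is sampled
a bounded expected number of times (`step_visits_add_le`).

If `θ` agrees with `μ` on the optimal action but prefers another one, an exchange argument
(`expectedReward_lt_of_swap`) shows that its action contains an arm `i` outside the optimal action
whose parameter under `θ` is at least `m = μ_{N-M+1}`. For `e < D(μ_i‖m)` and small `γ`, the `γ`-th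
moment of the ratio of this arm is at most `exp (-γ e)` (`eventually_ratioMoment_le`), so the `γ`-th
power of the full ratio times `exp (γ e n_i)`, with `n_i` the number of plays of `i`, is a
supermartingale. While it stays below `c`, the posterior of `θ` is `O(1 / T)` once `n_i ≥ log T /
e`, which costs `O(1)` samples in `T` rounds (`step_visits_le`). Every earlier sample plays `i` and
is charged to that arm, at most `log T / e + 1` times (`sum_plays_le`).

All of these are drift bounds for functions of the history; `exists_suboptimal_plays_le` adds them
into one potential and concludes by Markov's inequality. -/

/-! ### Bernoulli divergence and moments of likelihood ratios -/

/-- The mass function of the Bernoulli law, as a real number. -/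
def bern (p : ℝ) (b : Bool) : ℝ := if b then p else 1 - p

theorem bern_pos {p : ℝ} (hp : p ∈ Set.Ioo (0 : ℝ) 1) (b : Bool) : 0 < bern p b := by
  cases b <;> simp [bern, hp.1, hp.2]

theorem sum_bern (p : ℝ) : ∑ b, bern p b = 1 := by simp [bern]

theorem klBernoulli_nonneg {p q : ℝ} (hp : p ∈ Set.Ioo (0 : ℝ) 1) (hq : q ∈ Set.Ioo (0 : ℝ) 1) :
    0 ≤ klBernoulli p q := by
  obtain ⟨hp0, hp1⟩ := hp
  obtain ⟨hq0, hq1⟩ := hq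
  have hp1' : 0 < 1 - p := by linarith
  have hq1' : 0 < 1 - q := by linarith
  have h1 := Real.one_sub_inv_le_log_of_pos (div_pos hp0 hq0)
  have h2 := Real.one_sub_inv_le_log_of_pos (div_pos hp1' hq1')
  have h3 := mul_le_mul_of_nonneg_left h1 hp0.le
  have h4 := mul_le_mul_of_nonneg_left h2 hp1'.le
  have e1 : p * (1 - (p / q)⁻¹) = p - q := by field_simp
  have e2 : (1 - p) * (1 - ((1 - p) / (1 - q))⁻¹) = q - p := by field_simp; ring
  unfold klBernoulli
  linarith

theorem klBernoulli_pos {p q : ℝ} (hp : p ∈ Set.Ioo (0 : ℝ) 1) (hq : q ∈ Set.Ioo (0 : ℝ) 1)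
    (hpq : p ≠ q) : 0 < klBernoulli p q := by
  obtain ⟨hp0, hp1⟩ := hp
  obtain ⟨hq0, hq1⟩ := hq
  have hp1' : 0 < 1 - p := by linarith
  have hq1' : 0 < 1 - q := by linarith
  have h1 := Real.log_lt_sub_one_of_pos (div_pos hq0 hp0)
    (fun h => hpq ((div_eq_one_iff_eq hp0.ne').1 h).symm)
  have h2 := Real.log_le_sub_one_of_pos (div_pos hq1' hp1')
  have h3 := mul_lt_mul_of_pos_left h1 hp0
  have h4 := mul_le_mul_of_nonneg_left h2 hp1'.le
  have e1 : p * (q / p - 1) = q - p := by field_simp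
  have e2 : (1 - p) * ((1 - q) / (1 - p) - 1) = p - q := by field_simp; ring
  have l1 : Real.log (p / q) = - Real.log (q / p) := by rw [← Real.log_inv, inv_div]
  have l2 : Real.log ((1 - p) / (1 - q)) = - Real.log ((1 - q) / (1 - p)) := by
    rw [← Real.log_inv, inv_div]
  unfold klBernoulli
  rw [l1, l2]
  linarith

/-- The divergence from `p` increases when its second argument moves away to the right. -/
theorem klBernoulli_le_klBernoulli {p m q : ℝ} (hp : p ∈ Set.Ioo (0 : ℝ) 1)
    (hm : m ∈ Set.Ioo (0 : ℝ) 1) (hq : q ∈ Set.Ioo (0 : ℝ) 1) (hpm : p ≤ m) (hmq : m ≤ q) :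
    klBernoulli p m ≤ klBernoulli p q := by
  have h := klBernoulli_nonneg hm hq
  obtain ⟨hp0, hp1⟩ := hp
  obtain ⟨hm0, hm1⟩ := hm
  obtain ⟨hq0, hq1⟩ := hq
  have hp1' : 0 < 1 - p := by linarith
  have hm1' : 0 < 1 - m := by linarith
  have hq1' : 0 < 1 - q := by linarith
  have l1 := Real.log_le_log hm0 hmq
  have l2 : Real.log (1 - q) ≤ Real.log (1 - m) := Real.log_le_log hq1' (by linarith)
  unfold klBernoulli at *
  rw [Real.log_div hm0.ne' hq0.ne', Real.log_div hm1'.ne' hq1'.ne'] at h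
  rw [Real.log_div hp0.ne' hq0.ne', Real.log_div hp1'.ne' hq1'.ne',
    Real.log_div hp0.ne' hm0.ne', Real.log_div hp1'.ne' hm1'.ne']
  -- `D(p‖q) - D(p‖m) = D(m‖q) + (m - p) (log (q/m) + log ((1-m)/(1-q)))`, and both summands are
  -- nonnegative.
  nlinarith [mul_nonneg (sub_nonneg.2 hpm)
    (add_nonneg (sub_nonneg.2 l1) (sub_nonneg.2 l2))]

/-- The `γ`-th moment of the likelihood ratio between the Bernoulli laws with parameters `q`
and `p`, under the latter. -/
def ratioMoment (γ p q : ℝ) : ℝ := ∑ b, bern p b * (bern q b / bern p b) ^ γ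

theorem ratioMoment_nonneg (γ : ℝ) {p q : ℝ} (hp : p ∈ Set.Ioo (0 : ℝ) 1)
    (hq : q ∈ Set.Ioo (0 : ℝ) 1) : 0 ≤ ratioMoment γ p q :=
  Finset.sum_nonneg fun b _ => mul_nonneg (bern_pos hp b).le
    (Real.rpow_nonneg (div_nonneg (bern_pos hq b).le (bern_pos hp b).le) _)

theorem ratioMoment_one {p q : ℝ} (hp : p ∈ Set.Ioo (0 : ℝ) 1) : ratioMoment 1 p q = 1 := by
  refine Eq.trans ?_ (sum_bern q)
  refine Finset.sum_congr rfl fun b _ => ?_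
  rw [Real.rpow_one, mul_div_cancel₀ _ (bern_pos hp b).ne']

/-- Bernoulli's inequality for `(1 + s) ^ γ`. The linear correction sums to zero over `b`, which
bounds the moment by one. -/
theorem bern_mul_rpow_le {γ p q : ℝ} (hγ : γ ∈ Set.Ioo (0 : ℝ) 1) (hp : p ∈ Set.Ioo (0 : ℝ) 1)
    (hq : q ∈ Set.Ioo (0 : ℝ) 1) (b : Bool) :
    bern p b * (bern q b / bern p b) ^ γ ≤ bern p b + γ * (bern q b - bern p b) := by
  have hb := bern_pos hp b
  have h := rpow_one_add_le_one_add_mul_self (s := bern q b / bern p b - 1)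
    (by linarith [div_pos (bern_pos hq b) hb]) hγ.1.le hγ.2.le
  rw [add_sub_cancel] at h
  calc _ ≤ bern p b * (1 + γ * (bern q b / bern p b - 1)) := mul_le_mul_of_nonneg_left h hb.le
    _ = _ := by field_simp

theorem ratioMoment_le_one {γ p q : ℝ} (hγ : γ ∈ Set.Ioo (0 : ℝ) 1)
    (hp : p ∈ Set.Ioo (0 : ℝ) 1) (hq : q ∈ Set.Ioo (0 : ℝ) 1) : ratioMoment γ p q ≤ 1 := by
  refine (Finset.sum_le_sum fun b _ => bern_mul_rpow_le hγ hp hq b).trans_eq ?_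
  rw [Finset.sum_add_distrib, ← Finset.mul_sum, Finset.sum_sub_distrib, sum_bern, sum_bern]
  ring

theorem ratioMoment_lt_one {γ p q : ℝ} (hγ : γ ∈ Set.Ioo (0 : ℝ) 1)
    (hp : p ∈ Set.Ioo (0 : ℝ) 1) (hq : q ∈ Set.Ioo (0 : ℝ) 1) (hpq : q ≠ p) :
    ratioMoment γ p q < 1 := by
  have hs : bern p true * (bern q true / bern p true) ^ γ <
      bern p true + γ * (bern q true - bern p true) := by
    have hb := bern_pos hp true
    have h := rpow_one_add_lt_one_add_mul_self (s := bern q true / bern p true - 1)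
      (by linarith [div_pos (bern_pos hq true) hb])
      (fun h0 => hpq ((div_eq_one_iff_eq hp.1.ne').1 (sub_eq_zero.1 h0))) hγ.1 hγ.2
    rw [add_sub_cancel] at h
    calc _ < bern p true * (1 + γ * (bern q true / bern p true - 1)) :=
          mul_lt_mul_of_pos_left h hb
      _ = _ := by field_simp
  refine (Finset.sum_lt_sum (fun b _ => bern_mul_rpow_le hγ hp hq b)
    ⟨true, Finset.mem_univ _, hs⟩).trans_eq ?_
  rw [Finset.sum_add_distrib, ← Finset.mul_sum, Finset.sum_sub_distrib, sum_bern, sum_bern]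
  ring

/-- For small exponents, the moments of the likelihood ratio decay at a rate close to the
divergence. -/
theorem eventually_ratioMoment_le {p q a : ℝ} (hp : p ∈ Set.Ioo (0 : ℝ) 1)
    (hq : q ∈ Set.Ioo (0 : ℝ) 1) (ha : a < klBernoulli p q) :
    ∀ᶠ γ in nhdsWithin (0 : ℝ) (Set.Ioi 0), ratioMoment γ p q ≤ Real.exp (-(γ * a)) := by
  have hpos : ∀ b, 0 < bern q b / bern p b := fun b => div_pos (bern_pos hq b) (bern_pos hp b)
  -- The function equals 1 at `γ = 0` and has negative derivative there, so it is below 1 just to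
  -- the right of 0.
  have hd : HasDerivAt (fun γ : ℝ => ratioMoment γ p q * Real.exp (γ * a))
      (a - klBernoulli p q) 0 := by
    have h1 : HasDerivAt (fun γ : ℝ => ratioMoment γ p q)
        (∑ b, bern p b * (Real.log (bern q b / bern p b))) 0 := by
      refine HasDerivAt.fun_sum fun b _ => ?_
      have := ((hasDerivAt_id (0 : ℝ)).const_rpow (hpos b)).const_mul (bern p b)
      simpa using this
    have h2 : HasDerivAt (fun γ : ℝ => Real.exp (γ * a)) a 0 := by
      simpa using ((hasDerivAt_id (0 : ℝ)).mul_const a).exp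
    have h3 := h1.mul h2
    refine h3.congr_deriv ?_
    have l1 : Real.log (p / q) = - Real.log (q / p) := by rw [← Real.log_inv, inv_div]
    have l2 : Real.log ((1 - p) / (1 - q)) = - Real.log ((1 - q) / (1 - p)) := by
      rw [← Real.log_inv, inv_div]
    have e0 : ratioMoment 0 p q = 1 := by simp [ratioMoment, bern]
    simp only [e0, zero_mul, Real.exp_zero, mul_one, one_mul, klBernoulli, l1, l2]
    simp [bern]
    ring
  have hneg : a - klBernoulli p q < 0 := by linarith
  have hev := hd.hasDerivWithinAt (s := Set.Ioi 0)
  have hlim := (hasDerivWithinAt_iff_tendsto_slope' (by simp)).1 hev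
  filter_upwards [hlim.eventually (gt_mem_nhds hneg), self_mem_nhdsWithin] with γ h1 h2
  have h2' : (0 : ℝ) < γ := h2
  have e0 : ratioMoment 0 p q = 1 := by simp [ratioMoment, bern]
  rw [slope_def_field, div_lt_iff₀ (by linarith)] at h1
  simp only [e0, zero_mul, Real.exp_zero, mul_one] at h1
  rw [Real.exp_neg, ← one_div, le_div_iff₀ (Real.exp_pos _)]
  linarith

/-! ### Laws of the rewards and of the observations -/

theorem mem_Ioo_of_mem_grid {N : ℕ} {β : ℝ} (hβ : 0 < β) (θ : grid N β) (i : Fin N) :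
    θ.1 i ∈ Set.Ioo (0 : ℝ) 1 := by
  have h := Fintype.mem_piFinset.1 θ.2 i
  obtain ⟨k, hk, hki⟩ := Finset.mem_image.1 h
  rw [Finset.mem_Icc] at hk
  rw [← hki]
  have hk0 : (1 : ℝ) ≤ k := by exact_mod_cast hk.1
  refine ⟨by positivity, ?_⟩
  -- Since `1 ≤ k`, the truncated subtraction in the grid is a true one, which leaves room for `(k +
  -- 1) * β ≤ 1`.
  have h1 : k + 1 ≤ ⌊1 / β⌋₊ := by omega
  have h2 : ((k + 1 : ℕ) : ℝ) ≤ 1 / β :=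
    (Nat.le_floor_iff (by positivity)).1 h1
  rw [le_div_iff₀ hβ] at h2
  push_cast at h2
  linarith

theorem bernoulliLaw_apply {p : ℝ} (hp : p ∈ Set.Ioo (0 : ℝ) 1) (b : Bool) :
    bernoulliLaw p b = ENNReal.ofReal (bern p b) := by
  have : clamp p = p := by rw [clamp, min_eq_left hp.2.le, max_eq_right hp.1.le]
  simp [bernoulliLaw, bern, this]

theorem armsLaw_apply {N : ℕ} {θ : Fin N → ℝ} (hθ : ∀ i, θ i ∈ Set.Ioo (0 : ℝ) 1)
    (x : Fin N → Bool) : armsLaw θ x = ENNReal.ofReal (∏ i, bern (θ i) (x i)) := by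
  rw [ENNReal.ofReal_prod_of_nonneg fun i _ => (bern_pos (hθ i) _).le]
  simp [armsLaw, bernoulliLaw_apply (hθ _)]

theorem armsLaw_toReal {N : ℕ} {θ : Fin N → ℝ} (hθ : ∀ i, θ i ∈ Set.Ioo (0 : ℝ) 1)
    (x : Fin N → Bool) : (armsLaw θ x).toReal = ∏ i, bern (θ i) (x i) := by
  rw [armsLaw_apply hθ,
    ENNReal.toReal_ofReal (Finset.prod_nonneg fun i _ => (bern_pos (hθ i) _).le)]

/-- The expectation of a product of functions of the rewards of the arms in `a`. -/
theorem sum_prod_bern_mul_prod {N : ℕ} (θ : Fin N → ℝ) (a : Finset (Fin N))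
    (φ : Fin N → Bool → ℝ) :
    ∑ x : Fin N → Bool, (∏ i, bern (θ i) (x i)) * ∏ i ∈ a, φ i (x i) =
      ∏ i ∈ a, ∑ b, bern (θ i) b * φ i b := by
  have h1 : ∀ x : Fin N → Bool, (∏ i, bern (θ i) (x i)) * ∏ i ∈ a, φ i (x i) =
      ∏ i, bern (θ i) (x i) * (if i ∈ a then φ i (x i) else 1) := fun x => by
    rw [Finset.prod_mul_distrib, Finset.prod_ite_mem, Finset.univ_inter]
  simp_rw [h1]
  rw [← Fintype.prod_sum (fun i b => bern (θ i) b * (if i ∈ a then φ i b else 1)),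
    ← Finset.prod_subset (Finset.subset_univ a)]
  · exact Finset.prod_congr rfl fun i hi => by simp [hi]
  · intro i _ hi
    simpa [hi] using sum_bern (θ i)

theorem observe_eq_iff {N M : ℕ} (a : Action N M) (x x' : Fin N → Bool) :
    observe x' a = observe x a ↔ ∀ i ∈ a.1, x' i = x i := by
  constructor
  · intro h i hi
    have : i ∈ Set.range (a.1.orderEmbOfFin a.2) := by
      rw [Finset.range_orderEmbOfFin]; exact hi
    obtain ⟨k, rfl⟩ := this
    exact congrFun h k
  · intro h
    funext k
    exact h _ (Finset.orderEmbOfFin_mem a.1 a.2 k)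

theorem likelihood_observe {N M : ℕ} (a : Action N M) {θ : Fin N → ℝ}
    (hθ : ∀ i, θ i ∈ Set.Ioo (0 : ℝ) 1) (x : Fin N → Bool) :
    likelihood a θ (observe x a) = ENNReal.ofReal (∏ i ∈ a.1, bern (θ i) (x i)) := by
  -- With indicators as `φ`, the product formula marginalises the arms outside `a`.
  have h := sum_prod_bern_mul_prod θ a.1 (fun i b => if b = x i then 1 else 0)
  have h2 : ∏ i ∈ a.1, bern (θ i) (x i) =
      ∏ i ∈ a.1, ∑ b, bern (θ i) b * (if b = x i then 1 else 0) :=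
    Finset.prod_congr rfl fun i _ => by simp
  rw [h2, ← h, ENNReal.ofReal_sum_of_nonneg, likelihood, PMF.map_apply, tsum_fintype]
  · refine Finset.sum_congr rfl fun x' _ => ?_
    rw [Finset.prod_ite_zero]
    by_cases hx : ∀ i ∈ a.1, x' i = x i
    · rw [if_pos ((observe_eq_iff a x x').2 hx).symm, if_pos hx, armsLaw_apply hθ]
      simp
    · rw [if_neg fun h => hx ((observe_eq_iff a x x').1 h.symm), if_neg hx]
      simp
  · intro x' _
    exact mul_nonneg (Finset.prod_nonneg fun i _ => (bern_pos (hθ i) _).le)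
      (Finset.prod_nonneg fun i _ => by split_ifs <;> norm_num)

/-! ### Likelihood ratios along a history and the posterior -/

section Weight

variable {N M : ℕ} {β : ℝ}

/-- The product over the rounds of a history, and over the arms `i` played in each of them, of
the values of `φ i` at the observed rewards. -/
def weight (astar : grid N β → Action N M) (φ : Fin N → Bool → ℝ) :
    List (grid N β × (Fin N → Bool)) → ℝ
  | [] => 1
  | (θ, x) :: h => (∏ i ∈ (astar θ).1, φ i (x i)) * weight astar φ h

/-- The likelihood ratio of the rewards of one arm, between the models `θ` and `μ`. -/
def armRatio (μ θ : Fin N → ℝ) (i : Fin N) (b : Bool) : ℝ := bern (θ i) b / bern (μ i) b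

theorem armRatio_pos (hβ : 0 < β) (μ θ : grid N β) (i : Fin N) (b : Bool) :
    0 < armRatio μ.1 θ.1 i b :=
  div_pos (bern_pos (mem_Ioo_of_mem_grid hβ θ i) b) (bern_pos (mem_Ioo_of_mem_grid hβ μ i) b)

theorem weight_pos (astar : grid N β → Action N M) {φ : Fin N → Bool → ℝ}
    (hφ : ∀ i b, 0 < φ i b) (h : List (grid N β × (Fin N → Bool))) : 0 < weight astar φ h := by
  induction h with
  | nil => exact one_pos
  | cons r h ih => exact mul_pos (Finset.prod_pos fun i _ => hφ i _) ih

end Weight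

section Belief

variable {N M : ℕ} {β : ℝ} [Nonempty (grid N β)]

/-- The posterior mass of `θ` after the history `h`, as a real number. -/
def belief (astar : grid N β → Action N M) (h : List (grid N β × (Fin N → Bool)))
    (θ : grid N β) : ℝ :=
  (posterior (PMF.uniformOfFintype (grid N β)) (fun a θ => likelihood a θ.1) observe astar h
    θ).toReal

theorem belief_nonneg (astar : grid N β → Action N M) (h : List (grid N β × (Fin N → Bool)))
    (θ : grid N β) : 0 ≤ belief astar h θ := ENNReal.toReal_nonneg

theorem sum_pmf_toReal {Θ : Type*} [Fintype Θ] (ρ : PMF Θ) : ∑ θ, (ρ θ).toReal = 1 := by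
  rw [← ENNReal.toReal_sum fun θ _ => ρ.apply_ne_top θ, ← tsum_fintype (L := .unconditional _),
    ρ.tsum_coe, ENNReal.toReal_one]

theorem sum_belief (astar : grid N β → Action N M)
    (h : List (grid N β × (Fin N → Bool))) : ∑ θ, belief astar h θ = 1 := sum_pmf_toReal _

/-- Positivity of the likelihoods excludes the default branch of the update. -/
theorem bayesUpdate_toReal {Θ Y : Type*} [Fintype Θ] (ρ : PMF Θ) (l : Θ → PMF Y) (y : Y)
    (hl : ∀ θ, l θ y ≠ 0) (θ : Θ) :
    (bayesUpdate ρ l y θ).toReal =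
      (ρ θ).toReal * (l θ y).toReal / ∑ θ', (ρ θ').toReal * (l θ' y).toReal := by
  have hne : ∑' θ, ρ θ * l θ y ≠ 0 := by
    intro h0
    rw [ENNReal.tsum_eq_zero] at h0
    have : ∀ θ, ρ θ = 0 := fun θ => (mul_eq_zero.1 (h0 θ)).resolve_right (hl θ)
    have h1 := ρ.tsum_coe
    simp [this] at h1
  rw [bayesUpdate, dif_pos hne, PMF.normalize_apply, tsum_fintype, ENNReal.toReal_mul,
    ENNReal.toReal_inv, ENNReal.toReal_sum fun θ _ =>
      ENNReal.mul_ne_top (ρ.apply_ne_top θ) ((l θ).apply_ne_top y), ENNReal.toReal_mul]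
  simp_rw [ENNReal.toReal_mul]
  rfl

/-- The posterior mass is proportional to the likelihood ratio. -/
theorem belief_eq (hβ : 0 < β) (astar : grid N β → Action N M) (μ : grid N β)
    (h : List (grid N β × (Fin N → Bool))) (θ : grid N β) :
    belief astar h θ =
      weight astar (armRatio μ.1 θ.1) h / ∑ θ' : grid N β, weight astar (armRatio μ.1 θ'.1) h := by
  induction h generalizing θ with
  | nil =>
    simp [belief, posterior, weight]
  | cons r h ih =>
    obtain ⟨θ₀, x⟩ := r
    have hI := mem_Ioo_of_mem_grid (N := N) hβ
    have hpos : ∀ θ : grid N β, 0 < ∏ i ∈ (astar θ₀).1, bern (θ.1 i) (x i) := fun θ =>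
      Finset.prod_pos fun i _ => bern_pos (hI θ i) _
    have h1 : belief astar ((θ₀, x) :: h) θ =
        belief astar h θ * (∏ i ∈ (astar θ₀).1, bern (θ.1 i) (x i)) /
          ∑ θ' : grid N β, belief astar h θ' * ∏ i ∈ (astar θ₀).1, bern (θ'.1 i) (x i) := by
      have := bayesUpdate_toReal (posterior (PMF.uniformOfFintype (grid N β))
        (fun a θ => likelihood a θ.1) observe astar h) (fun θ => likelihood (astar θ₀) θ.1)
        (observe x (astar θ₀)) (fun θ => by
          rw [likelihood_observe _ (hI θ)]
          simpa using hpos θ) θ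
      simp_rw [fun θ : grid N β => likelihood_observe (astar θ₀) (hI θ) x,
        fun θ => ENNReal.toReal_ofReal (hpos θ).le] at this
      exact this
    have hw : ∀ θ : grid N β, weight astar (armRatio μ.1 θ.1) ((θ₀, x) :: h) =
        (∏ i ∈ (astar θ₀).1, bern (θ.1 i) (x i)) * weight astar (armRatio μ.1 θ.1) h /
          ∏ i ∈ (astar θ₀).1, bern (μ.1 i) (x i) := fun θ => by
      rw [weight]
      simp only [armRatio, Finset.prod_div_distrib]
      ring
    have hS : 0 < ∑ θ' : grid N β, weight astar (armRatio μ.1 θ'.1) h :=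
      Finset.sum_pos (fun θ _ => weight_pos astar (armRatio_pos hβ μ θ) h)
        Finset.univ_nonempty
    rw [h1]
    simp_rw [hw, ih]
    rw [← Finset.sum_div, div_div_div_cancel_right₀ (hpos μ).ne']
    simp_rw [div_mul_eq_mul_div]
    rw [← Finset.sum_div, div_div_div_cancel_right₀ hS.ne']
    simp_rw [mul_comm]

end Belief

/-! ### Expectations under Thompson sampling as iterated one-round expectations -/

section Step

variable {N M : ℕ} {β : ℝ} [Nonempty (grid N β)]

/-- The conditional expectation of `f` after the next round, given the history so far. -/
def step (astar : grid N β → Action N M) (μ : Fin N → ℝ)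
    (f : List (grid N β × (Fin N → Bool)) → ℝ) (h : List (grid N β × (Fin N → Bool))) : ℝ :=
  ∑ θ, belief astar h θ * ∑ x : Fin N → Bool, (∏ i, bern (μ i) (x i)) * f ((θ, x) :: h)

variable {astar : grid N β → Action N M} {μ : Fin N → ℝ}
  {f g : List (grid N β × (Fin N → Bool)) → ℝ} {h : List (grid N β × (Fin N → Bool))}

theorem sum_prod_bern {N : ℕ} (μ : Fin N → ℝ) :
    ∑ x : Fin N → Bool, ∏ i, bern (μ i) (x i) = 1 := by
  simpa using sum_prod_bern_mul_prod μ ∅ fun _ _ => 1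

theorem step_add : step astar μ (f + g) h = step astar μ f h + step astar μ g h := by
  simp only [step, Pi.add_apply, mul_add, Finset.sum_add_distrib]

theorem step_smul (c : ℝ) : step astar μ (c • f) h = c * step astar μ f h := by
  simp only [step, Pi.smul_apply, smul_eq_mul, Finset.mul_sum]
  exact Finset.sum_congr rfl fun θ _ => Finset.sum_congr rfl fun x _ => by ring

theorem step_sum {ι : Type*} (s : Finset ι) (F : ι → List (grid N β × (Fin N → Bool)) → ℝ) :
    step astar μ (∑ k ∈ s, F k) h = ∑ k ∈ s, step astar μ (F k) h := by
  classical
  induction s using Finset.induction_on with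
  | empty => simp [step]
  | insert k s hk ih => rw [Finset.sum_insert hk, Finset.sum_insert hk, step_add, ih]

/-- A function that does not depend on the rewards of the new round. -/
theorem step_of_forall {F : grid N β → ℝ} (hF : ∀ θ x, f ((θ, x) :: h) = F θ) :
    step astar μ f h = ∑ θ, belief astar h θ * F θ := by
  simp only [step, hF, ← Finset.sum_mul, sum_prod_bern, one_mul]

theorem step_const_of_forall {c : ℝ} (hF : ∀ r, f (r :: h) = c) : step astar μ f h = c := by
  rw [step_of_forall (F := fun _ => c) fun θ x => hF _, ← Finset.sum_mul, sum_belief, one_mul]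

theorem step_mono (hμ : ∀ i, μ i ∈ Set.Ioo (0 : ℝ) 1) (hfg : ∀ r, f (r :: h) ≤ g (r :: h)) :
    step astar μ f h ≤ step astar μ g h :=
  Finset.sum_le_sum fun _ _ => mul_le_mul_of_nonneg_left
    (Finset.sum_le_sum fun _ _ => mul_le_mul_of_nonneg_left (hfg _)
      (Finset.prod_nonneg fun i _ => (bern_pos (hμ i) _).le)) (belief_nonneg _ _ _)

theorem iterate_step_mono (hμ : ∀ i, μ i ∈ Set.Ioo (0 : ℝ) 1) (hfg : ∀ h, f h ≤ g h) (T : ℕ) :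
    ∀ h, (step astar μ)^[T] f h ≤ (step astar μ)^[T] g h := by
  induction T generalizing f g with
  | zero => exact hfg
  | succ T ih => exact ih fun h => step_mono hμ fun r => hfg _

theorem iterate_step_le (hμ : ∀ i, μ i ∈ Set.Ioo (0 : ℝ) 1) {c : ℝ}
    (hf : ∀ h, step astar μ f h ≤ f h + c) (T : ℕ) :
    ∀ h, (step astar μ)^[T] f h ≤ f h + T * c := by
  induction T with
  | zero => simp
  | succ T ih =>
    intro h
    rw [Function.iterate_succ_apply']
    calc _ ≤ step astar μ (f + fun _ => T * c) h := step_mono hμ fun r => ih _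
      _ = step astar μ f h + T * c := by
          rw [step_add, step_const_of_forall (f := fun _ => T * c) fun _ => rfl]
      _ ≤ _ := by push_cast; linarith [hf h]

theorem step_nonneg (hμ : ∀ i, μ i ∈ Set.Ioo (0 : ℝ) 1) (hf : ∀ r, 0 ≤ f (r :: h)) :
    0 ≤ step astar μ f h :=
  Finset.sum_nonneg fun _ _ => mul_nonneg (belief_nonneg _ _ _)
    (Finset.sum_nonneg fun _ _ => mul_nonneg
      (Finset.prod_nonneg fun i _ => (bern_pos (hμ i) _).le) (hf _))

theorem tsum_bind_mul {α γ : Type*} (p : PMF α) (k : α → PMF γ) (f : γ → ℝ≥0∞) :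
    ∑' c, (p.bind k) c * f c = ∑' a, p a * ∑' c, k a c * f c := by
  simp_rw [PMF.bind_apply, ← ENNReal.tsum_mul_right, ← ENNReal.tsum_mul_left]
  rw [ENNReal.tsum_comm]
  simp_rw [mul_assoc]

theorem tsum_pure_mul {γ : Type*} (c : γ) (f : γ → ℝ≥0∞) :
    ∑' c', (PMF.pure c) c' * f c' = f c := by
  rw [tsum_eq_single c fun c' hc => by simp [PMF.pure_apply, hc]]
  simp [PMF.pure_apply]

/-- The expectations under the law of Thompson sampling are computed by iterating `step`. -/
theorem tsum_subsetThompsonLaw_mul (hμ : ∀ i, μ i ∈ Set.Ioo (0 : ℝ) 1) (T : ℕ)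
    (hf : ∀ h, 0 ≤ f h) :
    ∑' h, subsetThompsonLaw astar μ T h * ENNReal.ofReal (f h) =
      ENNReal.ofReal ((step astar μ)^[T] f []) := by
  induction T generalizing f with
  | zero => exact tsum_pure_mul _ _
  | succ T ih =>
    rw [Function.iterate_succ_apply, ← ih fun h => step_nonneg hμ fun r => hf _,
      subsetThompsonLaw, thompsonLaw, tsum_bind_mul]
    refine tsum_congr fun h => ?_
    rw [subsetThompsonLaw]
    congr 1
    have hx : ∀ θ, 0 ≤ ∑ x : Fin N → Bool, (∏ i, bern (μ i) (x i)) * f ((θ, x) :: h) :=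
      fun θ => Finset.sum_nonneg fun x _ => mul_nonneg
        (Finset.prod_nonneg fun i _ => (bern_pos (hμ i) _).le) (hf _)
    rw [tsum_bind_mul, tsum_fintype, step, ENNReal.ofReal_sum_of_nonneg fun θ _ =>
      mul_nonneg (belief_nonneg _ _ _) (hx θ)]
    refine Finset.sum_congr rfl fun θ _ => ?_
    rw [ENNReal.ofReal_mul (belief_nonneg _ _ _), belief,
      ENNReal.ofReal_toReal (PMF.apply_ne_top _ _), tsum_bind_mul, tsum_fintype,
      ENNReal.ofReal_sum_of_nonneg fun x _ => mul_nonneg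
        (Finset.prod_nonneg fun i _ => (bern_pos (hμ i) _).le) (hf _)]
    congr 1
    refine Finset.sum_congr rfl fun x _ => ?_
    rw [tsum_pure_mul, armsLaw_apply hμ,
      ENNReal.ofReal_mul (Finset.prod_nonneg fun i _ => (bern_pos (hμ i) _).le)]

/-- If `V` is at least one outside `s` and increases by at most `c` per round in expectation,
then `s` has probability at least `1 - V [] - T * c`. -/
theorem le_subsetThompsonLaw_toOuterMeasure (hμ : ∀ i, μ i ∈ Set.Ioo (0 : ℝ) 1) (T : ℕ)
    (s : Set (List (grid N β × (Fin N → Bool)))) {V : List (grid N β × (Fin N → Bool)) → ℝ}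
    {c : ℝ} (hV0 : ∀ h, 0 ≤ V h) (hV1 : ∀ h, h ∉ s → 1 ≤ V h)
    (hV : ∀ h, step astar μ V h ≤ V h + c) :
    ENNReal.ofReal (1 - (V [] + T * c)) ≤ (subsetThompsonLaw astar μ T).toOuterMeasure s := by
  classical
  have h1 := tsum_subsetThompsonLaw_mul (astar := astar) hμ T (f := s.indicator fun _ => 1)
    (Set.indicator_nonneg fun _ _ => zero_le_one)
  have h2 : (subsetThompsonLaw astar μ T).toOuterMeasure s =
      ENNReal.ofReal ((step astar μ)^[T] (s.indicator fun _ => 1) []) := by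
    rw [← h1, PMF.toOuterMeasure_apply]
    refine tsum_congr fun h => ?_
    by_cases hs : h ∈ s <;> simp [hs]
  rw [h2]
  refine ENNReal.ofReal_le_ofReal ?_
  -- Pointwise the indicator of `s` is at least `1 - V`. The inequality is negated because drifts
  -- are bounded from above.
  have h3 : (step astar μ)^[T] (-s.indicator fun _ => 1) [] ≤
      (step astar μ)^[T] (V + fun _ => -1) [] := by
    refine iterate_step_mono hμ (fun h => ?_) T []
    by_cases hs : h ∈ s
    · simpa [hs] using hV0 h
    · simpa [hs] using hV1 h hs
  have h4 := iterate_step_le (astar := astar) hμ (f := V + fun _ => -1) (c := c) (fun h => by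
    rw [step_add, step_const_of_forall (f := fun _ => (-1 : ℝ)) fun _ => rfl]
    have := hV h
    simp only [Pi.add_apply]
    linarith) T []
  have h5 : ∀ T f, (step astar μ)^[T] (-f) = -(step astar μ)^[T] f := by
    intro T
    induction T with
    | zero => simp
    | succ T ih =>
      intro f
      rw [Function.iterate_succ_apply, Function.iterate_succ_apply, ← ih]
      congr 1
      funext h
      simpa using step_smul (astar := astar) (μ := μ) (f := f) (h := h) (-1)
  rw [h5] at h3
  simp only [Pi.neg_apply, Pi.add_apply] at h3 h4
  linarith

end Step

/-! ### Exchange argument for optimal actions -/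

/-- The reward of the arms in `a`, as a function of the rewards of all arms. -/
def utility {N : ℕ} (u : ℕ → ℝ) (a : Finset (Fin N)) (x : Fin N → Bool) : ℝ :=
  u (a.filter fun i => x i = true).card

theorem reward_observe {N M : ℕ} (u : ℕ → ℝ) (a : Action N M) (x : Fin N → Bool) :
    reward u (observe x a) = utility u a.1 x := by
  unfold reward utility observe
  congr 1
  have h : a.1 = Finset.univ.map (a.1.orderEmbOfFin a.2).toEmbedding := by
    ext i
    simp only [Finset.mem_map, Finset.mem_univ, true_and]
    rw [← Finset.mem_coe, ← Finset.range_orderEmbOfFin a.1 a.2]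
    rfl
  conv_rhs => rw [h, Finset.filter_map, Finset.card_map]
  rfl

theorem expectedReward_eq {N M : ℕ} (u : ℕ → ℝ) {θ : Fin N → ℝ}
    (hθ : ∀ i, θ i ∈ Set.Ioo (0 : ℝ) 1) (a : Action N M) :
    expectedReward u θ a = ∑ x : Fin N → Bool, (∏ i, bern (θ i) (x i)) * utility u a.1 x := by
  simp_rw [expectedReward, armsLaw_toReal hθ, reward_observe]

theorem card_filter_insert_erase {N : ℕ} {a : Finset (Fin N)} {i : Fin N} (hi : i ∈ a)
    (x : Fin N → Bool) :
    (a.filter fun k => x k = true).card =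
      ((a.erase i).filter fun k => x k = true).card + if x i = true then 1 else 0 := by
  conv_lhs => rw [← Finset.insert_erase hi, Finset.filter_insert]
  split_ifs
  · rw [Finset.card_insert_of_notMem (by simp)]
  · rfl

/-- Exchanging an arm for a better one strictly increases the expected reward. -/
theorem expectedReward_lt_of_swap {N M : ℕ} (u : ℕ → ℝ) (hu : MonotoneOn u (Set.Iic M))
    (hu' : u 0 < u M) {θ : Fin N → ℝ} (hθ : ∀ i, θ i ∈ Set.Ioo (0 : ℝ) 1) (a : Action N M)
    {i j : Fin N} (hi : i ∈ a.1) (hj : j ∉ a.1) (hij : θ i < θ j) :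
    ∃ a' : Action N M, expectedReward u θ a < expectedReward u θ a' := by
  have hne : i ≠ j := fun h => hj (h ▸ hi)
  -- `τ` exchanges the rewards of the arms `i` and `j`. The new action swaps `i` for `j`, so its
  -- utility is that of `a` composed with `τ`.
  let σ : Equiv.Perm (Fin N) := Equiv.swap i j
  let τ : Equiv.Perm (Fin N → Bool) := Equiv.arrowCongr σ (Equiv.refl Bool)
  have hτ : ∀ x k, τ x k = x (σ k) := fun x k => by simp [τ, σ, Equiv.arrowCongr]
  have hττ : ∀ x, τ (τ x) = x := fun x => by funext k; simp [hτ, σ]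
  set P : (Fin N → Bool) → ℝ := fun x => ∏ i, bern (θ i) (x i) with hP
  set R : (Fin N → Bool) → ℝ := fun x => ∏ k ∈ (Finset.univ.erase i).erase j, bern (θ k) (x k)
    with hR
  have hPR : ∀ x, P x = bern (θ i) (x i) * (bern (θ j) (x j) * R x) := fun x => by
    rw [hP, hR]
    dsimp only
    rw [Finset.mul_prod_erase (Finset.univ.erase i) (fun k => bern (θ k) (x k)) (by
      simp [hne.symm]), Finset.mul_prod_erase _ (fun k => bern (θ k) (x k)) (Finset.mem_univ i)]
  have hRpos : ∀ x, 0 < R x := fun x => Finset.prod_pos fun k _ => bern_pos (hθ k) _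
  have hRτ : ∀ x, R (τ x) = R x := fun x => Finset.prod_congr rfl fun k hk => by
    simp only [Finset.mem_erase, Finset.mem_univ, and_true] at hk
    rw [hτ, Equiv.swap_apply_of_ne_of_ne hk.2 hk.1]
  have hτi : ∀ x, τ x i = x j := fun x => by simp [hτ, σ]
  have hτj : ∀ x, τ x j = x i := fun x => by simp [hτ, σ]
  set U := utility u a.1 with hU
  have hc : ∀ x, ((a.1.erase i).filter fun k => τ x k = true) =
      (a.1.erase i).filter fun k => x k = true := fun x => Finset.filter_congr fun k hk => by
    rw [Finset.mem_erase] at hk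
    rw [hτ, show σ k = k from Equiv.swap_apply_of_ne_of_ne hk.1 fun h => hj (by
      rw [← h]; exact hk.2)]
  have hlt : ∀ x : Fin N → Bool, ((a.1.erase i).filter fun k => x k = true).card + 1 ≤ M :=
    fun x => by
      have h1 := Finset.card_filter_le (a.1.erase i) fun k => x k = true
      have h2 := Finset.card_erase_add_one hi
      have h3 := a.2
      omega
  have hdiff : ∀ x, x i = true → x j = false → U x - U (τ x) =
      u (((a.1.erase i).filter fun k => x k = true).card + 1) -
        u ((a.1.erase i).filter fun k => x k = true).card := fun x h1 h2 => by
    rw [hU, utility, utility, card_filter_insert_erase hi x, card_filter_insert_erase hi (τ x),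
      hc, hτi, h1, h2]
    simp
  have hPd : ∀ x, x i = true → x j = false → P (τ x) - P x = (θ j - θ i) * R x :=
    fun x h1 h2 => by
      rw [hPR, hPR, hRτ, hτi, hτj, h1, h2]
      simp only [bern]
      simp
      ring
  -- If the two rewards agree, `P` is invariant under `τ`; the two mixed cases are exchanged by `τ`,
  -- which leaves the product unchanged.
  have hterm : ∀ x, 0 ≤ (P (τ x) - P x) * (U x - U (τ x)) := by
    have key : ∀ x, x i = true → x j = false → 0 ≤ (P (τ x) - P x) * (U x - U (τ x)) :=
      fun x h1 h2 => by
        rw [hPd x h1 h2, hdiff x h1 h2]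
        have := hlt x
        exact mul_nonneg (mul_nonneg (sub_nonneg.2 hij.le) (hRpos x).le)
          (sub_nonneg.2 (hu (Set.mem_Iic.2 (by omega)) (Set.mem_Iic.2 this) (Nat.le_succ _)))
    intro x
    rcases h1 : x i with _ | _ <;> rcases h2 : x j with _ | _
    · have : P (τ x) = P x := by rw [hPR, hPR, hRτ, hτi, hτj, h1, h2]
      simp [this]
    · have := key (τ x) (by rw [hτi, h2]) (by rw [hτj, h1])
      rw [hττ] at this
      linarith
    · exact key x h1 h2
    · have : P (τ x) = P x := by rw [hPR, hPR, hRτ, hτi, hτj, h1, h2]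
      simp [this]
  -- At a strict increase of `u` from `s` to `s + 1`, the outcome `x₀` with exactly `s` successes
  -- among the other arms of `a`, a success on `i` and a failure on `j` gives a strictly positive
  -- term.
  obtain ⟨s, hsM, hs⟩ : ∃ s < M, u s < u (s + 1) := by
    by_contra! hcon
    have : ∀ k ≤ M, u k ≤ u 0 := by
      intro k
      induction k with
      | zero => simp
      | succ k ih => exact fun hk => (hcon k (by omega)).trans (ih (by omega))
    exact absurd (this M le_rfl) (not_le.2 hu')
  obtain ⟨b, hb, hbs⟩ := Finset.exists_subset_card_eq (s := a.1.erase i) (n := s) (by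
    have h2 := Finset.card_erase_add_one hi
    have h3 := a.2
    omega)
  have hib : i ∉ b := fun h => by simpa using hb h
  have hjb : j ∉ b := fun h => hj (Finset.mem_of_mem_erase (hb h))
  set x₀ : Fin N → Bool := fun k => decide (k ∈ insert i b) with hx₀
  have hx1 : x₀ i = true := by simp [hx₀]
  have hx2 : x₀ j = false := by simp [hx₀, hne.symm, hjb]
  have hx3 : ((a.1.erase i).filter fun k => x₀ k = true) = b := by
    ext k
    simp only [hx₀, Finset.mem_filter, Finset.mem_insert, decide_eq_true_eq]
    constructor
    · rintro ⟨h1, h2 | h2⟩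
      · exact absurd h2 (Finset.ne_of_mem_erase h1)
      · exact h2
    · exact fun h => ⟨hb h, Or.inr h⟩
  have hpos : 0 < ∑ x, (P (τ x) - P x) * (U x - U (τ x)) := by
    refine Finset.sum_pos' (fun x _ => hterm x) ⟨x₀, Finset.mem_univ _, ?_⟩
    rw [hPd x₀ hx1 hx2, hdiff x₀ hx1 hx2, hx3, hbs]
    exact mul_pos (mul_pos (sub_pos.2 hij) (hRpos _)) (sub_pos.2 hs)
  have e1 : ∑ x, P (τ x) * U (τ x) = ∑ x, P x * U x := Equiv.sum_comp τ fun x => P x * U x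
  have e2 : ∑ x, P (τ x) * U x = ∑ x, P x * U (τ x) := by
    rw [← Equiv.sum_comp τ]
    simp_rw [hττ]
  refine ⟨⟨a.1.map σ.toEmbedding, by rw [Finset.card_map, a.2]⟩, ?_⟩
  have hU' : ∀ x, utility u (a.1.map σ.toEmbedding) x = U (τ x) := fun x => by
    rw [hU, utility, utility, Finset.filter_map, Finset.card_map]
    congr 2
  rw [expectedReward_eq u hθ, expectedReward_eq u hθ]
  simp_rw [hU']
  -- By `e1` and `e2` the right-hand side is twice the gain in expected reward from the exchange.
  have e3 : ∑ x, (P (τ x) - P x) * (U x - U (τ x)) =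
      (∑ x, P (τ x) * U x - ∑ x, P (τ x) * U (τ x)) - (∑ x, P x * U x - ∑ x, P x * U (τ x)) := by
    rw [← Finset.sum_sub_distrib, ← Finset.sum_sub_distrib, ← Finset.sum_sub_distrib]
    exact Finset.sum_congr rfl fun x _ => by ring
  rw [e3, e1, e2] at hpos
  change ∑ x, P x * U x < ∑ x, P x * U (τ x)
  linarith

/-- Optimal actions consist of arms with the largest parameters. -/
theorem IsOptimalSelector.le_of_mem {N M : ℕ} {β : ℝ} (hβ : 0 < β) {u : ℕ → ℝ}
    (hu : MonotoneOn u (Set.Iic M)) (hu' : u 0 < u M) {astar : grid N β → Action N M}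
    (h : IsOptimalSelector u astar) (θ : grid N β) {i j : Fin N} (hi : i ∈ (astar θ).1)
    (hj : j ∉ (astar θ).1) : θ.1 j ≤ θ.1 i := by
  by_contra! hij
  obtain ⟨a', ha'⟩ := expectedReward_lt_of_swap u hu hu' (mem_Ioo_of_mem_grid hβ θ) (astar θ)
    hi hj hij
  exact absurd (h θ a') (not_le.2 ha')

/-- With a gap after the `M` largest parameters, the optimal action is the set of the `M`
last arms. -/
theorem IsOptimalSelector.mem_iff {N M : ℕ} {β : ℝ} (hβ : 0 < β) (hMN : M < N)
    {u : ℕ → ℝ} (hu : MonotoneOn u (Set.Iic M)) (hu' : u 0 < u M) {astar : grid N β → Action N M}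
    (h : IsOptimalSelector u astar) {μ : grid N β} (hμ : Monotone μ.1)
    {k l : Fin N} (hk : k.val = N - M - 1) (hl : l.val = N - M) (hgap : μ.1 k < μ.1 l) (i : Fin N) :
    i ∈ (astar μ).1 ↔ N - M ≤ i.val := by
  set top : Finset (Fin N) := Finset.Ici l with htop
  have hcard : top.card = M := by rw [htop, Fin.card_Ici]; omega
  have hsub : (astar μ).1 ⊆ top := by
    intro i hi
    by_contra hit
    obtain ⟨j, hj, hja⟩ : ∃ j ∈ top, j ∉ (astar μ).1 := by
      by_contra! hcon
      have := Finset.eq_of_subset_of_card_le hcon (by rw [hcard, (astar μ).2])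
      exact hit (this ▸ hi)
    have h1 := h.le_of_mem hβ hu hu' μ hi hja
    rw [htop, Finset.mem_Ici, not_le, Fin.lt_def] at hit
    rw [htop, Finset.mem_Ici] at hj
    have h2 : μ.1 i ≤ μ.1 k := hμ (by rw [Fin.le_def]; omega)
    have h3 := hμ hj
    linarith
  rw [Finset.eq_of_subset_of_card_le hsub (by rw [hcard, (astar μ).2]), htop, Finset.mem_Ici,
    Fin.le_def, hl]

/-! ### Splitting the suboptimal rounds -/

section Counting

variable {N M : ℕ} {β : ℝ}

/-- The number of rounds in which the arm `i` was played. -/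
def armPlays (astar : grid N β → Action N M) (i : Fin N) :
    List (grid N β × (Fin N → Bool)) → ℝ
  | [] => 0
  | (θ, _) :: h => armPlays astar i h + if i ∈ (astar θ).1 then 1 else 0

open Classical in
/-- The number of rounds in which `θ` was sampled after a history with the property `Q`. -/
def visits (θ : grid N β) (Q : List (grid N β × (Fin N → Bool)) → Prop) :
    List (grid N β × (Fin N → Bool)) → ℝ
  | [] => 0
  | (θ', _) :: h => visits θ Q h + if θ' = θ ∧ Q h then 1 else 0

theorem visits_nonneg (θ : grid N β) (Q : List (grid N β × (Fin N → Bool)) → Prop)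
    (h : List (grid N β × (Fin N → Bool))) : 0 ≤ visits θ Q h := by
  induction h with
  | nil => exact le_rfl
  | cons r h ih => exact add_nonneg ih (by split_ifs <;> norm_num)

open Classical in
theorem sum_visits_cons (s : Finset (grid N β))
    (Q : grid N β → List (grid N β × (Fin N → Bool)) → Prop)
    (r : grid N β × (Fin N → Bool)) (h : List (grid N β × (Fin N → Bool))) :
    ∑ θ ∈ s, visits θ (Q θ) (r :: h) =
      ∑ θ ∈ s, visits θ (Q θ) h + if r.1 ∈ s ∧ Q r.1 h then 1 else 0 := by
  simp only [visits, Finset.sum_add_distrib]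
  congr 1
  simp_rw [ite_and]
  rw [Finset.sum_ite_eq]

theorem sum_plays_cons (astar : grid N β → Action N M) (a₀ : Action N M)
    (r : grid N β × (Fin N → Bool)) (h : List (grid N β × (Fin N → Bool))) :
    ∑ a ∈ Finset.univ.erase a₀, plays astar (r :: h) a =
      ∑ a ∈ Finset.univ.erase a₀, plays astar h a + if astar r.1 = a₀ then 0 else 1 := by
  simp only [plays, List.countP_cons, Finset.sum_add_distrib, decide_eq_true_eq]
  congr 1
  rw [Finset.sum_ite_eq]
  simp only [Finset.mem_erase, Finset.mem_univ, and_true]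
  split_ifs <;> simp_all

/-- The rounds with a suboptimal action are split according to the sampled model: either it
belongs to `s`, or it belongs to `s'` and plays the arm `arm θ`, which happens after at most
`t + 1` plays of this arm or when it has been played at least `t` times. -/
theorem sum_plays_le {astar : grid N β → Action N M} {a₀ : Action N M}
    {s s' : Finset (grid N β)} {S : Finset (Fin N)} {arm : grid N β → Fin N} {t : Fin N → ℝ}
    {Q : List (grid N β × (Fin N → Bool)) → Prop} (hQ : ∀ r h, Q (r :: h) → Q h)
    (hcover : ∀ θ, astar θ ≠ a₀ → θ ∈ s ∨ θ ∈ s')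
    (harm : ∀ θ ∈ s', arm θ ∈ S ∧ arm θ ∈ (astar θ).1) (ht : ∀ i ∈ S, 0 ≤ t i)
    (h : List (grid N β × (Fin N → Bool))) (hh : Q h) :
    ((∑ a ∈ Finset.univ.erase a₀, plays astar h a : ℕ) : ℝ) ≤
      ∑ θ ∈ s, visits θ Q h +
        ∑ θ ∈ s', visits θ (fun h => Q h ∧ t (arm θ) ≤ armPlays astar (arm θ) h) h +
        ∑ i ∈ S, min (armPlays astar i h) (t i + 1) := by
  classical
  induction h with
  | nil =>
    simp only [plays, visits, armPlays, List.countP_nil, Finset.sum_const_zero, Nat.cast_zero,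
      add_zero, zero_add]
    exact Finset.sum_nonneg fun i hi => le_min le_rfl (by linarith [ht i hi])
  | cons r h ih =>
    have ih := ih (hQ r h hh)
    rw [sum_plays_cons, sum_visits_cons s fun _ => Q, sum_visits_cons s']
    have hle : ∀ i, min (armPlays astar i h) (t i + 1) ≤
        min (armPlays astar i (r :: h)) (t i + 1) := fun i =>
      min_le_min_right _ (by
        simp only [armPlays]
        split_ifs <;> linarith)
    have hsum := Finset.sum_le_sum fun i (_ : i ∈ S) => hle i
    push_cast at ih ⊢
    by_cases h1 : astar r.1 = a₀
    · rw [if_pos h1]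
      split_ifs <;> linarith
    · rw [if_neg h1]
      by_cases h2 : r.1 ∈ s
      · rw [if_pos (⟨h2, hQ r h hh⟩ : r.1 ∈ s ∧ Q h)]
        split_ifs <;> linarith
      · have h3 := (hcover r.1 h1).resolve_left h2
        rw [if_neg fun h4 => h2 h4.1]
        by_cases h4 : t (arm r.1) ≤ armPlays astar (arm r.1) h
        · rw [if_pos ⟨h3, hQ r h hh, h4⟩]
          linarith
        · rw [if_neg fun h5 => h4 h5.2.2]
          obtain ⟨hS, ha⟩ := harm r.1 h3
          -- Before this round the count is below `t`, so neither minimum is truncated and the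
          -- counter of the arm pays for the round. The extra 1 accommodates the play that crosses
          -- `t`.
          have h5 : min (armPlays astar (arm r.1) h) (t (arm r.1) + 1) + 1 ≤
              min (armPlays astar (arm r.1) (r :: h)) (t (arm r.1) + 1) := by
            simp only [armPlays, if_pos ha]
            push Not at h4
            rw [min_eq_left (by linarith), min_eq_left (by linarith)]
          have h6 := Finset.add_sum_erase S (fun i => min (armPlays astar i h) (t i + 1)) hS
          have h7 := Finset.add_sum_erase S
            (fun i => min (armPlays astar i (r :: h)) (t i + 1)) hS
          have h8 := Finset.sum_le_sum fun i (_ : i ∈ S.erase (arm r.1)) => hle i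
          linarith

end Counting

/-! ### Supermartingales and posterior bounds -/

section Weight

variable {N M : ℕ} {β : ℝ}

theorem weight_rpow (astar : grid N β → Action N M) {φ : Fin N → Bool → ℝ}
    (hφ : ∀ i b, 0 < φ i b) (γ : ℝ) (h : List (grid N β × (Fin N → Bool))) :
    weight astar (fun i b => φ i b ^ γ) h = weight astar φ h ^ γ := by
  induction h with
  | nil => simp [weight]
  | cons r h ih =>
    rw [weight, weight, ih, Real.mul_rpow (Finset.prod_nonneg fun i _ => (hφ i _).le)
      (weight_pos astar hφ h).le, Real.finsetProd_rpow _ _ fun i _ => (hφ i _).le]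

/-- A factor exponential in the number of plays is absorbed into the per-arm factors, so the tilted
ratio is again a `weight` and the same supermartingale criterion applies. -/
theorem weight_tilt (astar : grid N β → Action N M) (φ : Fin N → Bool → ℝ) (i₀ : Fin N) (a : ℝ)
    (h : List (grid N β × (Fin N → Bool))) :
    weight astar (fun i b => φ i b * if i = i₀ then Real.exp a else 1) h =
      weight astar φ h * Real.exp (a * armPlays astar i₀ h) := by
  induction h with
  | nil => simp [weight, armPlays]
  | cons r h ih =>
    rw [weight, weight, ih, Finset.prod_mul_distrib, Finset.prod_ite_eq', armPlays, mul_add,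
      Real.exp_add]
    split_ifs
    · rw [mul_one]; ring
    · rw [mul_zero, Real.exp_zero]; ring

variable [Nonempty (grid N β)] {astar : grid N β → Action N M} {μ : grid N β}

theorem step_weight (φ : Fin N → Bool → ℝ) (h : List (grid N β × (Fin N → Bool))) :
    step astar μ.1 (weight astar φ) h = weight astar φ h *
      ∑ θ, belief astar h θ * ∏ i ∈ (astar θ).1, ∑ b, bern (μ.1 i) b * φ i b := by
  rw [step, Finset.mul_sum]
  refine Finset.sum_congr rfl fun θ _ => ?_
  rw [← sum_prod_bern_mul_prod, mul_left_comm]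
  congr 1
  rw [Finset.mul_sum]
  exact Finset.sum_congr rfl fun x _ => by rw [weight]; ring

/-- Only the event that `μ` itself is sampled is used for a gain; the factors of all other models
are bounded by one. -/
theorem step_weight_le (hβ : 0 < β) {φ : Fin N → Bool → ℝ} (hφ : ∀ i b, 0 < φ i b)
    (hm : ∀ i, ∑ b, bern (μ.1 i) b * φ i b ≤ 1) (h : List (grid N β × (Fin N → Bool))) :
    step astar μ.1 (weight astar φ) h ≤ weight astar φ h * (1 - belief astar h μ *
      (1 - ∏ i ∈ (astar μ).1, ∑ b, bern (μ.1 i) b * φ i b)) := by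
  rw [step_weight]
  refine mul_le_mul_of_nonneg_left ?_ (weight_pos astar hφ h).le
  have hnn : ∀ i, 0 ≤ ∑ b, bern (μ.1 i) b * φ i b := fun i => Finset.sum_nonneg fun b _ =>
    mul_nonneg (bern_pos (mem_Ioo_of_mem_grid hβ μ i) b).le (hφ i b).le
  have h1 := Finset.add_sum_erase Finset.univ (fun θ => belief astar h θ) (Finset.mem_univ μ)
  rw [sum_belief] at h1
  rw [← Finset.add_sum_erase Finset.univ _ (Finset.mem_univ μ)]
  have h2 : ∑ θ ∈ Finset.univ.erase μ, belief astar h θ *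
      ∏ i ∈ (astar θ).1, ∑ b, bern (μ.1 i) b * φ i b ≤
        ∑ θ ∈ Finset.univ.erase μ, belief astar h θ :=
    Finset.sum_le_sum fun θ _ => mul_le_of_le_one_right (belief_nonneg _ _ _)
      (Finset.prod_le_one (fun i _ => hnn i) fun i _ => hm i)
  linarith

theorem step_weight_le_self (hβ : 0 < β) {φ : Fin N → Bool → ℝ} (hφ : ∀ i b, 0 < φ i b)
    (hm : ∀ i, ∑ b, bern (μ.1 i) b * φ i b ≤ 1) (h : List (grid N β × (Fin N → Bool))) :
    step astar μ.1 (weight astar φ) h ≤ weight astar φ h := by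
  refine (step_weight_le hβ hφ hm h).trans (mul_le_of_le_one_right (weight_pos astar hφ h).le ?_)
  have hnn : ∀ i, 0 ≤ ∑ b, bern (μ.1 i) b * φ i b := fun i => Finset.sum_nonneg fun b _ =>
    mul_nonneg (bern_pos (mem_Ioo_of_mem_grid hβ μ i) b).le (hφ i b).le
  have := mul_nonneg (belief_nonneg astar h μ) (sub_nonneg.2
    (Finset.prod_le_one (s := (astar μ).1) (fun i _ => hnn i) fun i _ => hm i))
  linarith

open Classical in
theorem step_visits (θ : grid N β) (Q : List (grid N β × (Fin N → Bool)) → Prop)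
    (h : List (grid N β × (Fin N → Bool))) :
    step astar μ.1 (visits θ Q) h = visits θ Q h + if Q h then belief astar h θ else 0 := by
  rw [step_of_forall (F := fun θ' => visits θ Q h + if θ' = θ ∧ Q h then 1 else 0)
    fun _ _ => rfl]
  simp only [mul_add, Finset.sum_add_distrib, ← Finset.sum_mul, sum_belief, one_mul]
  congr 1
  by_cases hq : Q h <;> simp [hq]

/-- The function `V` has stayed below `c` along the whole history. -/
def StaysBelow (V : List (grid N β × (Fin N → Bool)) → ℝ) (c : ℝ)
    (h : List (grid N β × (Fin N → Bool))) : Prop :=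
  ∀ h', h' <:+ h → V h' < c

omit [Nonempty (grid N β)] in
theorem staysBelow_cons {V : List (grid N β × (Fin N → Bool)) → ℝ} {c : ℝ}
    {r : grid N β × (Fin N → Bool)} {h : List (grid N β × (Fin N → Bool))} :
    StaysBelow V c (r :: h) ↔ V (r :: h) < c ∧ StaysBelow V c h := by
  simp only [StaysBelow, List.suffix_cons_iff, or_imp, forall_and, forall_eq]

open Classical in
/-- The supermartingale behind the maximal inequality: `V`, set to `c` once it has reached `c`. -/
theorem step_cap_le (hμ : ∀ i, μ.1 i ∈ Set.Ioo (0 : ℝ) 1)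
    {V : List (grid N β × (Fin N → Bool)) → ℝ} (hV : ∀ h, step astar μ.1 V h ≤ V h) (c : ℝ)
    (h : List (grid N β × (Fin N → Bool))) :
    step astar μ.1 (fun h => if StaysBelow V c h then V h else c) h ≤
      if StaysBelow V c h then V h else c := by
  by_cases hh : StaysBelow V c h
  · rw [if_pos hh]
    refine (step_mono hμ fun r => ?_).trans (hV h)
    simp only [staysBelow_cons, hh, and_true]
    split_ifs with h1
    · exact le_rfl
    · exact not_lt.1 h1
  · rw [if_neg hh]
    exact (step_const_of_forall fun r => by simp only [staysBelow_cons, hh, and_false,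
      if_false]).le

omit [Nonempty (grid N β)] in
theorem weight_armRatio_self (hβ : 0 < β) (h : List (grid N β × (Fin N → Bool))) :
    weight astar (armRatio μ.1 μ.1) h = 1 := by
  have : armRatio μ.1 μ.1 = fun _ _ => (1 : ℝ) := by
    funext i b
    exact div_self (bern_pos (mem_Ioo_of_mem_grid hβ μ i) b).ne'
  rw [this]
  induction h with
  | nil => rfl
  | cons r h ih => simp [weight, ih]

/-- The normalising sum contains the ratio of `μ` to itself, which is 1. -/
theorem belief_le_weight (hβ : 0 < β) (h : List (grid N β × (Fin N → Bool))) (θ : grid N β) :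
    belief astar h θ ≤ weight astar (armRatio μ.1 θ.1) h := by
  have hpos := fun θ => weight_pos astar (armRatio_pos hβ μ θ) h
  rw [belief_eq hβ astar μ]
  refine div_le_self (hpos θ).le ?_
  rw [← weight_armRatio_self hβ h (μ := μ) (astar := astar)]
  exact Finset.single_le_sum (f := fun θ : grid N β => weight astar (armRatio μ.1 θ.1) h)
    (fun θ _ => (hpos θ).le) (Finset.mem_univ μ)

/-- The posterior mass is at most `min w 1` for the likelihood ratio `w`, and `min w 1 ≤ w ^ γ`. -/
theorem belief_le_rpow (hβ : 0 < β) (h : List (grid N β × (Fin N → Bool))) (θ : grid N β)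
    {γ : ℝ} (hγ : γ ∈ Set.Ioo (0 : ℝ) 1) :
    belief astar h θ ≤ weight astar (armRatio μ.1 θ.1) h ^ γ := by
  have hpos := weight_pos astar (armRatio_pos hβ μ θ) h
  rcases le_total (weight astar (armRatio μ.1 θ.1) h) 1 with h1 | h1
  · refine (belief_le_weight (μ := μ) hβ h θ).trans ?_
    simpa using Real.rpow_le_rpow_of_exponent_ge hpos h1 hγ.2.le
  · refine le_trans ?_ (Real.one_le_rpow h1 hγ.1.le)
    rw [← sum_belief astar h]
    exact Finset.single_le_sum (f := fun θ => belief astar h θ)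
      (fun θ _ => belief_nonneg astar h θ) (Finset.mem_univ θ)

theorem inv_le_belief (hβ : 0 < β) (h : List (grid N β × (Fin N → Bool))) {c : ℝ}
    (hc : ∑ θ : grid N β, weight astar (armRatio μ.1 θ.1) h ≤ c) : c⁻¹ ≤ belief astar h μ := by
  have hpos := fun θ => weight_pos astar (armRatio_pos hβ μ θ) h
  rw [belief_eq hβ astar μ, weight_armRatio_self hβ, one_div]
  exact inv_anti₀ (Finset.sum_pos (fun θ _ => hpos θ) Finset.univ_nonempty) hc

end Weight

/-! ### The logarithmic bound -/

section Main

variable {N M : ℕ} {β : ℝ} [Nonempty (grid N β)] {astar : grid N β → Action N M} {μ : grid N β}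

open Classical in
/-- A model that differs from the truth on an arm of the optimal action is sampled a bounded
number of times in expectation, as long as the likelihood ratios are bounded. -/
theorem step_visits_add_le (hβ : 0 < β) {γ : ℝ} (hγ : γ ∈ Set.Ioo (0 : ℝ) 1) {c : ℝ}
    (hc : 0 < c) {V : List (grid N β × (Fin N → Bool)) → ℝ}
    (hV : ∀ h, ∑ θ : grid N β, weight astar (armRatio μ.1 θ.1) h ≤ V h) {θ : grid N β} {g : ℝ}
    (hg : g = 1 - ∏ i ∈ (astar μ).1, ratioMoment γ (μ.1 i) (θ.1 i)) (hg0 : 0 < g)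
    (h : List (grid N β × (Fin N → Bool))) :
    step astar μ.1 (visits θ (StaysBelow V c) + (c / g) • fun h =>
      if StaysBelow V c h then weight astar (armRatio μ.1 θ.1) h ^ γ else 0) h ≤
    (visits θ (StaysBelow V c) + (c / g) • fun h =>
      if StaysBelow V c h then weight astar (armRatio μ.1 θ.1) h ^ γ else 0) h := by
  have hI := mem_Ioo_of_mem_grid (N := N) hβ
  rw [step_add, step_smul, step_visits]
  simp only [Pi.add_apply, Pi.smul_apply, smul_eq_mul]
  by_cases hh : StaysBelow V c h
  · rw [if_pos hh, if_pos hh]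
    have hφ : ∀ i b, 0 < armRatio μ.1 θ.1 i b ^ γ := fun i b =>
      Real.rpow_pos_of_pos (armRatio_pos hβ μ θ i b) γ
    have h1 : step astar μ.1 (fun h =>
        if StaysBelow V c h then weight astar (armRatio μ.1 θ.1) h ^ γ else 0) h ≤
          step astar μ.1 (weight astar fun i b => armRatio μ.1 θ.1 i b ^ γ) h :=
      step_mono (hI μ) fun r => by
        rw [weight_rpow astar (armRatio_pos hβ μ θ)]
        split_ifs
        · exact le_rfl
        · exact Real.rpow_nonneg (weight_pos astar (armRatio_pos hβ μ θ) _).le _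
    have h2 := step_weight_le (astar := astar) hβ hφ
      (fun i => ratioMoment_le_one hγ (hI μ i) (hI θ i)) h
    rw [weight_rpow astar (armRatio_pos hβ μ θ)] at h2
    have h3 : 1 - ∏ i ∈ (astar μ).1, ∑ b, bern (μ.1 i) b * armRatio μ.1 θ.1 i b ^ γ = g := hg.symm
    rw [h3] at h2
    have h4 := inv_le_belief (astar := astar) hβ h
      ((hV h).trans (hh h List.suffix_rfl).le)
    have h5 := belief_le_rpow (astar := astar) (μ := μ) hβ h θ hγ
    set w := weight astar (armRatio μ.1 θ.1) h ^ γ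
    have hw : 0 ≤ w := Real.rpow_nonneg (weight_pos astar (armRatio_pos hβ μ θ) h).le _
    have h6 : w * (1 - belief astar h μ * g) ≤ w * (1 - c⁻¹ * g) := by gcongr
    -- The coefficient `c / g` makes the expected loss equal to `w`, which pays for the expected new
    -- visit, at most `w`.
    have h7 : c / g * (w * (1 - c⁻¹ * g)) = c / g * w - w := by field_simp
    have h8 := mul_le_mul_of_nonneg_left (h1.trans (h2.trans h6)) (div_pos hc hg0).le
    linarith
  · rw [if_neg hh, if_neg hh, step_const_of_forall (c := 0) fun r => by
      simp only [staysBelow_cons, hh, and_false, if_false]]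
    linarith

open Classical in
/-- After `log T / e` plays of the arm `i`, a model for which the tilted likelihood ratio is
bounded has a posterior mass of order `1 / T`. -/
theorem step_visits_le (hβ : 0 < β) {γ : ℝ} (hγ : 0 < γ) {c : ℝ} (hc : 0 < c)
    {V : List (grid N β × (Fin N → Bool)) → ℝ} {θ : grid N β} {i : Fin N} {e T : ℝ} (he : 0 < e)
    (hT : 0 < T)
    (hV : ∀ h, weight astar (armRatio μ.1 θ.1) h ^ γ *
      Real.exp (γ * e * armPlays astar i h) ≤ V h) (h : List (grid N β × (Fin N → Bool))) :
    step astar μ.1 (visits θ fun h => StaysBelow V c h ∧ Real.log T / e ≤ armPlays astar i h) h ≤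
      visits θ (fun h => StaysBelow V c h ∧ Real.log T / e ≤ armPlays astar i h) h +
        c ^ γ⁻¹ / T := by
  rw [step_visits]
  refine add_le_add le_rfl ?_
  split_ifs with hh
  · obtain ⟨h1, h2⟩ := hh
    have hpos := weight_pos astar (armRatio_pos hβ μ θ) h
    refine (belief_le_weight (μ := μ) hβ h θ).trans ?_
    rw [le_div_iff₀ hT, Real.le_rpow_inv_iff_of_pos (mul_pos hpos hT).le hc.le hγ,
      Real.mul_rpow hpos.le hT.le]
    refine le_trans ?_ ((hV h).trans (h1 h List.suffix_rfl).le)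
    refine mul_le_mul_of_nonneg_left ?_ (Real.rpow_nonneg hpos.le _)
    -- `T ^ γ = exp (γ log T)`, and `log T ≤ e n` after `n ≥ log T / e` plays.
    rw [Real.rpow_def_of_pos hT, Real.exp_le_exp]
    rw [div_le_iff₀ he] at h2
    nlinarith
  · positivity

/-- The logarithmic bound for the number of suboptimal plays. The arms outside the optimal action
are in `S`, and a suboptimal action that is optimal in a model which agrees with the truth on the
optimal action contains an arm of `S` whose parameter is at least `m` in that model. -/
theorem exists_suboptimal_plays_le (hβ : 0 < β) {S : Finset (Fin N)} (hS : S.Nonempty) {m : ℝ}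
    (hm : m ∈ Set.Ioo (0 : ℝ) 1) (hSm : ∀ i ∈ S, μ.1 i < m)
    (hsel : ∀ θ, astar θ ≠ astar μ → (∀ j ∈ (astar μ).1, θ.1 j = μ.1 j) →
      ∃ i ∈ S, i ∈ (astar θ).1 ∧ m ≤ θ.1 i)
    {δ r : ℝ} (hδ : δ ∈ Set.Ioo (0 : ℝ) 1) (hr : 1 < r) :
    ∃ B : ℝ, ∀ T : ℕ, 1 ≤ T →
      ENNReal.ofReal (1 - δ) ≤ (subsetThompsonLaw astar μ.1 T).toOuterMeasure
        {h | ((∑ a ∈ Finset.univ.erase (astar μ), plays astar h a : ℕ) : ℝ) ≤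
          B + r * (∑ i ∈ S, 1 / klBernoulli (μ.1 i) m) * Real.log T} := by
  classical
  obtain ⟨hδ0, hδ1⟩ := hδ
  have hr0 : 0 < r := by linarith
  have hI := mem_Ioo_of_mem_grid (N := N) hβ
  have hd : ∀ i ∈ S, 0 < klBernoulli (μ.1 i) m := fun i hi =>
    klBernoulli_pos (hI μ i) hm (hSm i hi).ne
  -- `K` holds the models refuted by playing the optimal action, `L` the suboptimal ones that it
  -- cannot distinguish from the truth.
  set K : Finset (grid N β) := Finset.univ.filter fun θ => ∃ j ∈ (astar μ).1, θ.1 j ≠ μ.1 j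
  set L : Finset (grid N β) := Finset.univ.filter fun θ =>
    astar θ ≠ astar μ ∧ ∀ j ∈ (astar μ).1, θ.1 j = μ.1 j
  have hLex : ∀ θ, ∃ i, θ ∈ L → i ∈ S ∧ i ∈ (astar θ).1 ∧ m ≤ θ.1 i := fun θ => by
    by_cases hθ : θ ∈ L
    · obtain ⟨h1, h2⟩ := (Finset.mem_filter.1 hθ).2
      obtain ⟨i, hi⟩ := hsel θ h1 h2
      exact ⟨i, fun _ => hi⟩
    · exact ⟨hS.choose, fun h => absurd h hθ⟩
  choose arm harm using hLex
  -- Dividing by `r > 1` puts the rate strictly below the divergence, so one small `γ` serves all of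
  -- the finite set `L`; it also produces the factor `r` in `log T / e`.
  set e : grid N β → ℝ := fun θ => klBernoulli (μ.1 (arm θ)) m / r with he
  have he0 : ∀ θ ∈ L, 0 < e θ := fun θ hθ => div_pos (hd _ (harm θ hθ).1) hr0
  obtain ⟨γ, hγm, hγ0, hγ1⟩ : ∃ γ : ℝ, (∀ θ ∈ L,
      ratioMoment γ (μ.1 (arm θ)) (θ.1 (arm θ)) ≤ Real.exp (-(γ * e θ))) ∧ 0 < γ ∧ γ < 1 := by
    have h1 : ∀ᶠ γ in nhdsWithin (0 : ℝ) (Set.Ioi 0), ∀ θ ∈ L,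
        ratioMoment γ (μ.1 (arm θ)) (θ.1 (arm θ)) ≤ Real.exp (-(γ * e θ)) := by
      refine (Filter.eventually_all_finset L).2 fun θ hθ => ?_
      obtain ⟨h2, -, h3⟩ := harm θ hθ
      refine eventually_ratioMoment_le (hI μ _) (hI θ _) ?_
      exact (div_lt_self (hd _ h2) hr).trans_le
        (klBernoulli_le_klBernoulli (hI μ _) hm (hI θ _) (hSm _ h2).le h3)
    have h2 : ∀ᶠ γ in nhdsWithin (0 : ℝ) (Set.Ioi 0), γ ∈ Set.Ioo (0 : ℝ) 1 :=
      Ioo_mem_nhdsGT one_pos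
    obtain ⟨γ, h3, h4⟩ := (h1.and h2).exists
    exact ⟨γ, h3, h4.1, h4.2⟩
  have hγ : γ ∈ Set.Ioo (0 : ℝ) 1 := ⟨hγ0, hγ1⟩
  -- the likelihood ratios and the tilted likelihood ratios
  set W : grid N β → List (grid N β × (Fin N → Bool)) → ℝ := fun θ =>
    weight astar (armRatio μ.1 θ.1) with hW
  set φ : grid N β → Fin N → Bool → ℝ := fun θ i b =>
    armRatio μ.1 θ.1 i b ^ γ * if i = arm θ then Real.exp (γ * e θ) else 1 with hφdef
  have hφ : ∀ θ i b, 0 < φ θ i b := fun θ i b =>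
    mul_pos (Real.rpow_pos_of_pos (armRatio_pos hβ μ θ i b) γ)
      (by split_ifs; exacts [Real.exp_pos _, one_pos])
  have hWpos : ∀ θ h, 0 < W θ h := fun θ h => weight_pos astar (armRatio_pos hβ μ θ) h
  have hMpos : ∀ θ h, 0 < weight astar (φ θ) h := fun θ h => weight_pos astar (hφ θ) h
  set V : List (grid N β × (Fin N → Bool)) → ℝ :=
    ∑ θ, W θ + ∑ θ ∈ L, weight astar (φ θ) with hVdef
  have hVapp : ∀ h, V h = ∑ θ, W θ h + ∑ θ ∈ L, weight astar (φ θ) h := fun h => by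
    simp [hVdef]
  have hVW : ∀ h, ∑ θ, W θ h ≤ V h := fun h => by
    rw [hVapp]
    exact le_add_of_nonneg_right (Finset.sum_nonneg fun θ _ => (hMpos θ h).le)
  have hVM : ∀ θ ∈ L, ∀ h, W θ h ^ γ * Real.exp (γ * e θ * armPlays astar (arm θ) h) ≤ V h := by
    intro θ hθ h
    have h1 : weight astar (φ θ) h =
        W θ h ^ γ * Real.exp (γ * e θ * armPlays astar (arm θ) h) := by
      rw [hφdef, weight_tilt, weight_rpow astar (armRatio_pos hβ μ θ)]
    rw [← h1, hVapp]
    have h2 := Finset.single_le_sum (f := fun θ => weight astar (φ θ) h)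
      (fun θ _ => (hMpos θ h).le) hθ
    have h3 : 0 ≤ ∑ θ, W θ h := Finset.sum_nonneg fun θ _ => (hWpos θ h).le
    linarith
  have hVstep : ∀ h, step astar μ.1 V h ≤ V h := fun h => by
    rw [hVdef, step_add, step_sum, step_sum, Pi.add_apply, Finset.sum_apply, Finset.sum_apply]
    refine add_le_add (Finset.sum_le_sum fun θ _ => ?_) (Finset.sum_le_sum fun θ hθ => ?_)
    · refine step_weight_le_self hβ (armRatio_pos hβ μ θ) (fun i => ?_) h
      have := ratioMoment_one (q := θ.1 i) (hI μ i)
      simp only [ratioMoment, Real.rpow_one] at this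
      exact this.le
    · refine step_weight_le_self hβ (hφ θ) (fun i => ?_) h
      have h1 : ∑ b, bern (μ.1 i) b * φ θ i b = ratioMoment γ (μ.1 i) (θ.1 i) *
          if i = arm θ then Real.exp (γ * e θ) else 1 := by
        rw [ratioMoment, Finset.sum_mul]
        exact Finset.sum_congr rfl fun b _ => (mul_assoc _ _ _).symm
      rw [h1]
      split_ifs with h2
      · rw [h2]
        calc _ ≤ Real.exp (-(γ * e θ)) * Real.exp (γ * e θ) :=
              mul_le_mul_of_nonneg_right (hγm θ hθ) (Real.exp_pos _).le
          _ = 1 := by rw [← Real.exp_add, neg_add_cancel, Real.exp_zero]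
      · rw [mul_one]
        exact ratioMoment_le_one hγ (hI μ i) (hI θ i)
  have hVpos : ∀ h, 0 < V h := fun h =>
    (Finset.sum_pos (fun θ _ => hWpos θ h) Finset.univ_nonempty).trans_le (hVW h)
  -- With this level, the maximal inequality bounds the probability that `V` ever reaches `c` by `δ
  -- / 2`.
  set c : ℝ := 2 * V [] / δ with hcdef
  have hc : 0 < c := div_pos (mul_pos two_pos (hVpos _)) hδ0
  have hVc : V [] < c := by
    rw [hcdef, lt_div_iff₀ hδ0]
    nlinarith [hVpos []]
  clear_value c
  set Q := StaysBelow V c with hQ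
  -- the gap between one and the Hellinger-type affinity
  set g : grid N β → ℝ := fun θ => 1 - ∏ i ∈ (astar μ).1, ratioMoment γ (μ.1 i) (θ.1 i)
  have hg0 : ∀ θ ∈ K, 0 < g θ := fun θ hθ => by
    obtain ⟨j, hj, hne⟩ := (Finset.mem_filter.1 hθ).2
    refine sub_pos.2 ?_
    rw [← Finset.mul_prod_erase _ _ hj]
    refine (mul_le_of_le_one_right (ratioMoment_nonneg γ (hI μ j) (hI θ j))
      (Finset.prod_le_one (fun i _ => ratioMoment_nonneg γ (hI μ i) (hI θ i))
        fun i _ => ratioMoment_le_one hγ (hI μ i) (hI θ i))).trans_lt ?_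
    exact ratioMoment_lt_one hγ (hI μ j) (hI θ j) hne
  set F : grid N β → List (grid N β × (Fin N → Bool)) → ℝ := fun θ =>
    visits θ Q + (c / g θ) • fun h => if Q h then W θ h ^ γ else 0 with hF
  have hFv : ∀ θ ∈ K, ∀ h, visits θ Q h ≤ F θ h := fun θ hθ h => by
    refine le_add_of_nonneg_right (mul_nonneg (div_pos hc (hg0 θ hθ)).le ?_)
    dsimp only
    split_ifs
    exacts [Real.rpow_nonneg (hWpos θ h).le _, le_rfl]
  have hFstep : ∀ θ ∈ K, ∀ h, step astar μ.1 (F θ) h ≤ F θ h := fun θ hθ h =>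
    step_visits_add_le hβ hγ hc hVW rfl (hg0 θ hθ) h
  have hQnil : Q [] := fun h' hh => by
    rw [List.suffix_nil] at hh
    rwa [hh]
  have hFnil : ∀ θ, F θ [] = c / g θ := fun θ => by
    simp [hF, visits, hQnil, hW, weight]
  -- Initial value of the potential `Z` below, plus its total drift over `T` rounds, in which `T`
  -- cancels; the 1 ensures positivity.
  set B₀ : ℝ := ∑ θ ∈ K, c / g θ + L.card * c ^ γ⁻¹ + 1 with hB₀
  have hK0 : 0 ≤ ∑ θ ∈ K, c / g θ := Finset.sum_nonneg fun θ hθ => (div_pos hc (hg0 θ hθ)).le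
  have hB₀pos : 0 < B₀ := by positivity
  set z : ℝ := 2 * B₀ / δ with hz
  have hzpos : 0 < z := by positivity
  clear_value z B₀
  -- `z` is the Markov threshold for `Z` at level `δ / 2`; `S.card` collects the extra 1 of each
  -- arm.
  refine ⟨z + S.card, fun T hT => ?_⟩
  have hT0 : (0 : ℝ) < T := by exact_mod_cast hT
  have hlog : 0 ≤ Real.log T := Real.log_nonneg (by exact_mod_cast hT)
  set t : Fin N → ℝ := fun i => r * Real.log T / klBernoulli (μ.1 i) m with ht
  have hte : ∀ θ, Real.log T / e θ = t (arm θ) := fun θ => by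
    rw [he, ht, div_div_eq_mul_div, mul_comm]
  set G : grid N β → List (grid N β × (Fin N → Bool)) → ℝ := fun θ =>
    visits θ fun h => Q h ∧ t (arm θ) ≤ armPlays astar (arm θ) h with hG
  have hGstep : ∀ θ ∈ L, ∀ h, step astar μ.1 (G θ) h ≤ G θ h + c ^ γ⁻¹ / T := fun θ hθ h => by
    have := step_visits_le (astar := astar) (μ := μ) hβ hγ0 hc (he0 θ hθ) hT0 (hVM θ hθ) h
    rwa [hte] at this
  set Φ : List (grid N β × (Fin N → Bool)) → ℝ := fun h => if Q h then V h else c with hΦ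
  have hΦstep : ∀ h, step astar μ.1 Φ h ≤ Φ h := step_cap_le (hI μ) hVstep c
  set Z : List (grid N β × (Fin N → Bool)) → ℝ := ∑ θ ∈ K, F θ + ∑ θ ∈ L, G θ with hZdef
  have hZapp : ∀ h, Z h = ∑ θ ∈ K, F θ h + ∑ θ ∈ L, G θ h := fun h => by simp [hZdef]
  have hZ0 : ∀ h, 0 ≤ Z h := fun h => by
    rw [hZapp]
    exact add_nonneg (Finset.sum_nonneg fun θ hθ => (visits_nonneg θ _ h).trans (hFv θ hθ h))
      (Finset.sum_nonneg fun θ _ => visits_nonneg θ _ h)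
  have hZstep : ∀ h, step astar μ.1 Z h ≤ Z h + L.card * (c ^ γ⁻¹ / T) := fun h => by
    rw [hZapp, hZdef, step_add, step_sum, step_sum, add_assoc]
    refine add_le_add (Finset.sum_le_sum fun θ hθ => hFstep θ hθ h) ?_
    rw [← nsmul_eq_mul, ← Finset.sum_const, ← Finset.sum_add_distrib]
    exact Finset.sum_le_sum fun θ hθ => hGstep θ hθ h
  have hΦ0 : ∀ h, 0 ≤ Φ h := fun h => by
    rw [hΦ]
    dsimp only
    split_ifs
    exacts [(hVpos h).le, hc.le]
  have hmain := le_subsetThompsonLaw_toOuterMeasure (astar := astar) (hI μ) T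
    {h | ((∑ a ∈ Finset.univ.erase (astar μ), plays astar h a : ℕ) : ℝ) ≤
      z + S.card + r * (∑ i ∈ S, 1 / klBernoulli (μ.1 i) m) * Real.log T}
    -- On a bad history either `V` has reached `c`, so the first summand is 1, or the count of plays
    -- forces `Z > z`, so the second exceeds 1. Each summand has budget `δ / 2`.
    (V := c⁻¹ • Φ + z⁻¹ • Z) (c := z⁻¹ * (L.card * (c ^ γ⁻¹ / T)))
    (fun h => add_nonneg (mul_nonneg (inv_pos.2 hc).le (hΦ0 h))
      (mul_nonneg (inv_pos.2 hzpos).le (hZ0 h)))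
    (fun h hh => ?_) (fun h => ?_)
  · refine (ENNReal.ofReal_le_ofReal ?_).trans hmain
    have h1 : Φ [] = V [] := if_pos hQnil
    have h2 : Z [] = ∑ θ ∈ K, c / g θ := by
      rw [hZapp]
      simp [hFnil, hG, visits]
    have h3 : c⁻¹ * V [] = δ / 2 := by
      rw [hcdef, inv_div, div_mul_eq_mul_div, mul_div_mul_right _ _ (hVpos []).ne']
    have h4 : z⁻¹ * B₀ = δ / 2 := by
      rw [hz, inv_div, div_mul_eq_mul_div, mul_div_mul_right _ _ hB₀pos.ne']
    have h5 : (T : ℝ) * (z⁻¹ * (L.card * (c ^ γ⁻¹ / T))) = z⁻¹ * (L.card * c ^ γ⁻¹) := by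
      rw [mul_left_comm, mul_left_comm (T : ℝ), mul_div_cancel₀ _ hT0.ne']
    simp only [Pi.add_apply, Pi.smul_apply, smul_eq_mul]
    rw [h1, h2, h3, h5]
    have h6 : 0 < z⁻¹ := inv_pos.2 hzpos
    rw [hB₀] at h4
    linarith
  · simp only [Pi.add_apply, Pi.smul_apply, smul_eq_mul]
    by_cases hq : Q h
    · have h1 := sum_plays_le (astar := astar) (a₀ := astar μ) (s := K) (s' := L) (S := S)
        (arm := arm) (t := t) (Q := Q) (fun r h hh => (staysBelow_cons.1 hh).2)
        (fun θ hθ => by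
          by_cases h2 : ∃ j ∈ (astar μ).1, θ.1 j ≠ μ.1 j
          · exact Or.inl (Finset.mem_filter.2 ⟨Finset.mem_univ _, h2⟩)
          · push Not at h2
            exact Or.inr (Finset.mem_filter.2 ⟨Finset.mem_univ _, hθ, h2⟩))
        (fun θ hθ => ⟨(harm θ hθ).1, (harm θ hθ).2.1⟩)
        (fun i hi => div_nonneg (mul_nonneg hr0.le hlog) (hd i hi).le) h hq
      have h2 : ∑ i ∈ S, min (armPlays astar i h) (t i + 1) ≤
          r * (∑ i ∈ S, 1 / klBernoulli (μ.1 i) m) * Real.log T + S.card := by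
        calc _ ≤ ∑ i ∈ S, (t i + 1) := Finset.sum_le_sum fun i _ => min_le_right _ _
          _ = _ := by
            rw [Finset.sum_add_distrib, Finset.mul_sum, Finset.sum_mul]
            congr 1
            · exact Finset.sum_congr rfl fun i _ => by rw [ht]; ring
            · simp
      have h3 : ∑ θ ∈ K, visits θ Q h ≤ ∑ θ ∈ K, F θ h :=
        Finset.sum_le_sum fun θ hθ => hFv θ hθ h
      have h4 : z < Z h := by
        rw [Set.mem_ofPred_eq, not_le] at hh
        rw [hZapp]
        linarith
      have h5 : 1 ≤ z⁻¹ * Z h := by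
        rw [← div_eq_inv_mul, one_le_div hzpos]
        exact h4.le
      have h6 := mul_nonneg (inv_pos.2 hc).le (hΦ0 h)
      linarith
    · have h1 : Φ h = c := if_neg hq
      rw [h1, inv_mul_cancel₀ hc.ne']
      have := mul_nonneg (inv_pos.2 hzpos).le (hZ0 h)
      linarith
  · rw [step_add, step_smul, step_smul]
    simp only [Pi.add_apply, Pi.smul_apply, smul_eq_mul]
    have h1 := mul_le_mul_of_nonneg_left (hΦstep h) (inv_pos.2 hc).le
    have h2 := mul_le_mul_of_nonneg_left (hZstep h) (inv_pos.2 hzpos).le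
    linarith

end Main

/-- For `M = 1` the constant of the logarithmic bound is the Lai-Robbins constant. -/
theorem sum_one_div_klBernoulli_eq_laiRobbinsConstant {N : ℕ} {μ : Fin N → ℝ}
    (hμ : Monotone μ) {k l : Fin N} (hk : k.val = N - 1 - 1) (hl : l.val = N - 1)
    (hgap : μ k < μ l) :
    ∑ i ∈ Finset.univ.filter (fun i : Fin N => i.val < N - 1), 1 / klBernoulli (μ i) (μ l) =
      laiRobbinsConstant μ := by
  have hlast : ∀ i : Fin N, i ≤ l := fun i => by rw [Fin.le_def]; omega
  have : Nonempty (Fin N) := ⟨l⟩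
  have hsup : ⨆ j, μ j = μ l :=
    le_antisymm (ciSup_le fun i => hμ (hlast i)) (le_ciSup (Set.finite_range μ).bddAbove _)
  rw [laiRobbinsConstant, hsup]
  congr 1
  -- The gap lies just before the last arm, so the suboptimal arms are exactly those before it.
  refine Finset.filter_congr fun i _ => ⟨fun h => (hμ ?_).trans_lt hgap, fun h => ?_⟩
  · rw [Fin.le_def]
    omega
  · by_contra hi
    have : i = l := le_antisymm (hlast i) (by rw [Fin.le_def]; omega)
    rw [this] at h
    exact lt_irrefl _ h

end

end SubsetBandit

open SubsetBandit in
theorem corollary2 (N M : ℕ) (hM : 1 ≤ M) (hMN : M < N)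
    (β : ℝ) (hβ : β ∈ Set.Ioo (0 : ℝ) 1) [Nonempty (grid N β)]
    (u : ℕ → ℝ) (hu : MonotoneOn u (Set.Iic M)) (hu' : u 0 < u M)
    (δ ε : ℝ) (hδ : δ ∈ Set.Ioo (0 : ℝ) 1) (hε : ε ∈ Set.Ioo (0 : ℝ) 1) :
    ∃ B₂ : ℝ, ∀ astar : grid N β → Action N M, IsOptimalSelector u astar →
      ∀ μ : grid N β, Monotone μ.1 →
        μ.1 ⟨N - M - 1, by omega⟩ < μ.1 ⟨N - M, by omega⟩ →
        (∃ Tstar : ℕ, ∀ T : ℕ, Tstar ≤ T →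
          ENNReal.ofReal (1 - δ) ≤
            (subsetThompsonLaw astar μ.1 T).toOuterMeasure
              {h | ((∑ a ∈ Finset.univ.erase (astar μ), plays astar h a : ℕ) : ℝ) ≤
                B₂ + (1 + ε) / (1 - ε) *
                  (∑ i ∈ Finset.univ.filter (fun i : Fin N => i.val < N - M),
                    1 / klBernoulli (μ.1 i) (μ.1 ⟨N - M, by omega⟩)) * Real.log T}) ∧
        (M = 1 →
          ∑ i ∈ Finset.univ.filter (fun i : Fin N => i.val < N - M),
            1 / klBernoulli (μ.1 i) (μ.1 ⟨N - M, by omega⟩) = laiRobbinsConstant μ.1) := by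
  have hI := mem_Ioo_of_mem_grid (N := N) hβ.1
  -- Selectors and models form a finite type. The assumptions are moved behind the constant so that
  -- every pair has one, and a common bound serves as `B₂`.
  have key : ∀ p : (grid N β → Action N M) × grid N β, ∃ B : ℝ, IsOptimalSelector u p.1 →
      Monotone p.2.1 → p.2.1 ⟨N - M - 1, by omega⟩ < p.2.1 ⟨N - M, by omega⟩ →
      ∀ T : ℕ, 1 ≤ T → ENNReal.ofReal (1 - δ) ≤
        (subsetThompsonLaw p.1 p.2.1 T).toOuterMeasure
          {h | ((∑ a ∈ Finset.univ.erase (p.1 p.2), plays p.1 h a : ℕ) : ℝ) ≤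
            B + (1 + ε) / (1 - ε) *
              (∑ i ∈ Finset.univ.filter (fun i : Fin N => i.val < N - M),
                1 / klBernoulli (p.2.1 i) (p.2.1 ⟨N - M, by omega⟩)) * Real.log T} := by
    rintro ⟨astar, μ⟩
    by_cases h : IsOptimalSelector u astar ∧ Monotone μ.1 ∧
      μ.1 ⟨N - M - 1, by omega⟩ < μ.1 ⟨N - M, by omega⟩
    · obtain ⟨hopt, hμ, hgap⟩ := h
      have hmem := hopt.mem_iff hβ.1 hMN hu hu' hμ rfl rfl hgap
      obtain ⟨B, hB⟩ := exists_suboptimal_plays_le (astar := astar) (μ := μ) hβ.1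
        (S := Finset.univ.filter fun i : Fin N => i.val < N - M)
        ⟨⟨0, by omega⟩, by simp; omega⟩ (hI μ ⟨N - M, by omega⟩)
        (fun i hi => (hμ (by
          rw [Fin.le_def]
          have := (Finset.mem_filter.1 hi).2
          simp only
          omega)).trans_lt hgap)
        -- Distinct actions of equal size each contain an arm missing from the other. Optimality
        -- under `θ` gives `θ_i ≥ θ_j`, and `θ_j = μ_j ≥ μ_{N-M+1}` because `j` is in the optimal
        -- action.
        (fun θ hne hθ => by
          obtain ⟨i, hi, hi'⟩ : ∃ i ∈ (astar θ).1, i ∉ (astar μ).1 := by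
            by_contra! hcon
            exact hne (Subtype.ext (Finset.eq_of_subset_of_card_le hcon
              (by rw [(astar θ).2, (astar μ).2])))
          obtain ⟨j, hj, hj'⟩ : ∃ j ∈ (astar μ).1, j ∉ (astar θ).1 := by
            by_contra! hcon
            exact hne (Subtype.ext (Finset.eq_of_subset_of_card_le hcon
              (by rw [(astar θ).2, (astar μ).2])).symm)
          refine ⟨i, ?_, hi, ?_⟩
          · rw [hmem, not_le] at hi'
            simpa using hi'
          · have h1 := hopt.le_of_mem hβ.1 hu hu' θ hi hj'
            rw [hθ j hj] at h1
            exact (hμ ((hmem j).1 hj)).trans h1)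
        hδ (r := (1 + ε) / (1 - ε)) (by
          rw [lt_div_iff₀ (by linarith [hε.2])]
          linarith [hε.1])
      exact ⟨B, fun _ _ _ => hB⟩
    · exact ⟨0, fun h1 h2 h3 => absurd ⟨h1, h2, h3⟩ h⟩
  choose B hB using key
  obtain ⟨B₂, hB₂⟩ := (Set.finite_range B).bddAbove
  refine ⟨B₂, fun astar hopt μ hμ hgap => ⟨⟨1, fun T hT => ?_⟩, ?_⟩⟩
  · refine (hB (astar, μ) hopt hμ hgap T hT).trans
      ((subsetThompsonLaw astar μ.1 T).toOuterMeasure.mono fun h hh => ?_)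
    have h1 := hB₂ ⟨(astar, μ), rfl⟩
    rw [Set.mem_ofPred_eq] at hh ⊢
    linarith
  · rintro rfl
    exact sum_one_div_klBernoulli_eq_laiRobbinsConstant hμ rfl rfl hgap
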